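/- Let $K$ be a complete discretely valued field with ring of integers $\mathcal O$, uniformiser $\pi$ and residue field $\mathbb F=\mathcal O/\pi\mathcal O$. Let $V$ be a finite-dimensional $K$-vector space, $G$ a group, and $\rho\colon G\to \mathrm{GL}(V)$ an irreducible representation for which at least one $\rho(G)$-stable $\mathcal O$-lattice in $V$ exists. Let $X(\rho)$ be the simplicial complex whose vertices are the homothety classes of $\rho(G)$-stable lattices in $V$, where vertices $x_0,\dots,x_n$ form an $n$-dimensional face if they have representatives with $\pi\Lambda_0\subsetneq\Lambda_1\subsetneq\dots\subsetneq\Lambda_n\subsetneq\Lambda_0$; it is a subcomplex of the Bruhat--Tits building of $\mathrm{PGL}(V)$. A stable lattice $\Lambda$ is normalised at a nonzero $v\in V$ if $v\in\Lambda\setminus\pi\Lambda$. A vertex of $X(\rho)$ is maximal if, for some nonzero $v\in V$, it is represented by a lattice that is maximal with respect to inclusion among the stable lattices normalised at $v$. A vertex $x$ of $X(\rho)$ is extremal if for all points $y,z$ of the geometric realisation of $X(\rho)$, whenever $x$ lies on the geodesic $[yz]$ of the building, $x=y$ or $x=z$. Let $X_{\max}(\rho)$ and $X_{\mathrm{ext}}(\rho)$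 be the sets of maximal and of extremal vertices. Write the semisimplification of $\Lambda/\pi\Lambda$, for a stable lattice $\Lambda$ (it does not depend on $\Lambda$), as $\bar\rho^{ss}\simeq\bigoplus_{i=1}^r W_i^{m_i}$ with $W_1,\dots,W_r$ pairwise non-isomorphic irreducible representations of $G$ over $\mathbb F$. Then $$|X_{\max}(\rho)|\ \ge\ 1+\dim X(\rho)\ =\ \sum_{i=1}^r m_i ,$$ with $|X_{\max}(\rho)|=1+\dim X(\rho)$ if $\rho$ is residually multiplicity free, i.e. if $m_i=1$ for all $i$. Moreover $$|X_{\mathrm{ext}}(\rho)|\ \ge\ 1+\dim X(\rho).$$ -/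

import Mathlib

open scoped Pointwise MonoidAlgebra

noncomputable section

namespace StableLattices

section Building

variable (O K V : Type*) [CommRing O] [Field K] [Algebra O K] [AddCommGroup V]
  [Module K V] [Module O V] [IsScalarTower O K V]

/-- A lattice in `V`: a finitely generated `O`-submodule that spans `V` over `K`. Over a discrete
valuation ring `O` with fraction field `K` these are exactly the free `O`-submodules of rank
`dim_K V`. -/
abbrev Lattice : Type _ := {L : Submodule O V // Submodule.IsLattice K L}

/-- Homothety of lattices: `L₂ = a L₁` for some `a ∈ Kˣ`. -/
def homothety : Setoid (Lattice O K V) where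
  r L₁ L₂ := ∃ a : Kˣ, L₂.1 = a • L₁.1
  iseqv :=
    { refl := fun L => ⟨1, by simp⟩
      symm := by
        rintro L₁ L₂ ⟨a, h⟩
        exact ⟨a⁻¹, by rw [h, inv_smul_smul]⟩
      trans := by
        rintro L₁ L₂ L₃ ⟨a, h⟩ ⟨b, h'⟩
        exact ⟨b * a, by rw [h', h, mul_smul]⟩ }

/-- The vertices of the Bruhat-Tits building: homothety classes of lattices. -/
abbrev Vertex : Type _ := Quotient (homothety O K V)

variable {O K V}

/-- The homothety class of a lattice. -/
def Lattice.vertex (L : Lattice O K V) : Vertex O K V := Quotient.mk (homothety O K V) L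

/-- The Bruhat-Tits building of `PGL(V)` as an abstract simplicial complex. A set of `n + 1`
vertices is a face when there are representatives with `π Λ₀ ⊂ Λ₁ ⊂ ... ⊂ Λₙ ⊂ Λ₀`, all
inclusions being strict; here `L` lists them as `Λ₁, ..., Λₙ, Λ₀`. -/
def building (π : O) : PreAbstractSimplicialComplex (Vertex O K V) where
  faces := {s | ∃ (n : ℕ) (L : Fin (n + 1) → Lattice O K V),
    StrictMono (fun i => (L i).1) ∧ π • (L (Fin.last n)).1 < (L 0).1 ∧
    ∀ x, x ∈ s ↔ ∃ i, (L i).vertex = x}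
  isRelLowerSet_faces := by
    classical
    rintro s ⟨n, L, hL, hπ, hs⟩
    refine ⟨⟨(L 0).vertex, (hs _).2 ⟨0, rfl⟩⟩, ?_⟩
    intro t hts ht
    let I : Finset (Fin (n + 1)) := Finset.univ.filter (fun i => (L i).vertex ∈ t)
    have hI : I.Nonempty := by
      obtain ⟨x, hx⟩ := ht
      obtain ⟨i, hi⟩ := (hs x).1 (hts hx)
      exact ⟨i, by simp [I, hi, hx]⟩
    obtain ⟨k, hk⟩ : ∃ k, I.card = k + 1 := ⟨I.card - 1, by have := hI.card_pos; omega⟩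
    refine ⟨k, fun i => L (I.orderEmbOfFin hk i), ?_, ?_, ?_⟩
    · exact fun i j hij => hL ((I.orderEmbOfFin hk).strictMono hij)
    · refine lt_of_le_of_lt (Submodule.map_mono (hL.monotone (Fin.le_last _))) (hπ.trans_le ?_)
      exact hL.monotone (Fin.zero_le _)
    · intro x
      constructor
      · intro hx
        obtain ⟨i, hi⟩ := (hs x).1 (hts hx)
        have hiI : i ∈ I := by simp [I, hi, hx]
        have : i ∈ Set.range (I.orderEmbOfFin hk) := by
          rw [Finset.range_orderEmbOfFin]; exact hiI
        obtain ⟨j, hj⟩ := this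
        exact ⟨j, by simp only [hj, hi]⟩
      · rintro ⟨j, hj⟩
        have := Finset.orderEmbOfFin_mem I hk j
        simp only [I, Finset.mem_filter, Finset.mem_univ, true_and] at this
        exact hj ▸ this

/-- `x` is the vertex of the apartment of the basis `b` represented by the lattice
`Span_O {π ^ n₁ b₁, ..., π ^ n_d b_d}`. -/
def HasExponents (π : O) {ι : Type*} (b : Module.Basis ι K V) (x : Vertex O K V)
    (n : ι → ℤ) : Prop :=
  ∃ L : Lattice O K V, L.vertex = x ∧
    L.1 = Submodule.span O (Set.range fun i => (algebraMap O K π) ^ n i • b i)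

/-- The point `p` (in barycentric coordinates) lies in the apartment of the basis `b`, and
`a` represents its position in the Euclidean space `ℝ^d / ℝ(1, ..., 1)`. The identification of
the apartment with this space is affine on each simplex and sends the vertex of
`Span_O {π ^ n₁ b₁, ..., π ^ n_d b_d}` to the class of `(n₁, ..., n_d)`. -/
def HasCoordinates (π : O) {ι : Type*} (b : Module.Basis ι K V) (p : Vertex O K V →₀ ℝ)
    (a : ι → ℝ) : Prop :=
  ∃ n : Vertex O K V → ι → ℤ, (∀ x ∈ p.support, HasExponents π b x (n x)) ∧
    ∃ c : ℝ, ∀ i, a i = c + p.sum fun x w => w * (n x i : ℝ)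

/-- The point `r` lies on the geodesic `[p q]` of the geometric realisation of the building:
in an apartment that contains these points, `r` is on the straight line segment
from `p` to `q`. -/
def MemGeodesic (π : O) (p q r : Vertex O K V →₀ ℝ) : Prop :=
  ∃ (b : Module.Basis (Fin (Module.finrank K V)) K V)
    (a a' : Fin (Module.finrank K V) → ℝ) (t : ℝ),
    0 ≤ t ∧ t ≤ 1 ∧ HasCoordinates π b p a ∧ HasCoordinates π b q a' ∧
    HasCoordinates π b r (fun i => (1 - t) * a i + t * a' i)

end Building

section Complex

variable {α : Type*}

/-- The dimension of a (nonempty) simplicial complex. -/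
def dim (X : PreAbstractSimplicialComplex α) : ℕ∞ :=
  ⨆ s ∈ X.faces, ((s.card - 1 : ℕ) : ℕ∞)

/-- The geometric realisation of a simplicial complex, in barycentric coordinates. -/
def realisation (X : PreAbstractSimplicialComplex α) : Set (α →₀ ℝ) :=
  {p | (∀ x, 0 ≤ p x) ∧ p.support ∈ X.faces ∧ (p.sum fun _ w => w) = 1}

end Complex

section Invariant

variable {O K V G : Type*} [CommRing O] [Field K] [Algebra O K] [AddCommGroup V]
  [Module K V] [Module O V] [IsScalarTower O K V] [Group G] (ρ : Representation K G V)

/-- `L` is `ρ(G)`-stable. -/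
def IsStable (L : Submodule O V) : Prop := ∀ g : G, ∀ v ∈ L, ρ g v ∈ L

/-- The vertex `x` is represented by a `ρ(G)`-stable lattice. -/
def IsStableVertex (x : Vertex O K V) : Prop :=
  ∃ L : Lattice O K V, L.vertex = x ∧ IsStable ρ L.1

/-- The complex `X(ρ)`: the subcomplex of the building spanned by the vertices that are
represented by `ρ(G)`-stable lattices. -/
def invariantComplex (π : O) : PreAbstractSimplicialComplex (Vertex O K V) where
  faces := {s | s ∈ (building π : PreAbstractSimplicialComplex (Vertex O K V)).faces ∧
    ∀ x ∈ s, IsStableVertex ρ x}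
  isRelLowerSet_faces := by
    rintro s ⟨hs, hs'⟩
    refine ⟨((building π).isRelLowerSet_faces hs).1, fun t hts ht => ?_⟩
    exact ⟨((building π).isRelLowerSet_faces hs).2 hts ht, fun x hx => hs' x (hts hx)⟩

/-- The set of stable lattices normalised at `v`: `v ∈ L`, and its image in `L / π L` is nonzero. -/
def normalisedAt (π : O) (v : V) : Set (Lattice O K V) :=
  {L | IsStable ρ L.1 ∧ v ∈ L.1 ∧ v ∉ π • L.1}

/-- The set of maximal vertices: those represented, for some nonzero `v`, by a
lattice that is maximal for inclusion among the stable lattices normalised at `v`. -/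
def maximalVertices (π : O) : Set (Vertex O K V) :=
  {x | ∃ v : V, v ≠ 0 ∧ ∃ L : Lattice O K V, L.vertex = x ∧
    Maximal (fun M => M ∈ normalisedAt ρ π v) L}

/-- The set of extremal vertices of `X(ρ)`: the vertices `x` such that, for all points `y`, `z`
of the geometric realisation of `X(ρ)`, if `x ∈ [y z]`, then `x = y` or `x = z`. -/
def extremalVertices (π : O) : Set (Vertex O K V) :=
  {x | IsStableVertex ρ x ∧
    ∀ y ∈ realisation (invariantComplex (O := O) ρ π),
    ∀ z ∈ realisation (invariantComplex (O := O) ρ π),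
      MemGeodesic π y z (Finsupp.single x 1) →
        Finsupp.single x 1 = y ∨ Finsupp.single x 1 = z}

end Invariant

section Residual

/-- `S` is a semisimplification of the module `M` of finite length: the direct sum of the
successive quotients of a composition series of `M`. -/
def IsSemisimplification (A M S : Type*) [Ring A] [AddCommGroup M] [Module A M]
    [AddCommGroup S] [Module A S] : Prop :=
  ∃ s : CompositionSeries (Submodule A M), s.head = ⊥ ∧ s.last = ⊤ ∧
    Nonempty (S ≃ₗ[A] ((i : Fin s.length) →
      s.toFun i.succ ⧸ (s.toFun i.castSucc).submoduleOf (s.toFun i.succ)))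

variable {O K V G : Type*} [CommRing O] [IsLocalRing O] [Field K] [Algebra O K] [AddCommGroup V]
  [Module K V] [Module O V] [IsScalarTower O K V] [Group G] (ρ : Representation K G V)

/-- The residue field. -/
abbrev ResField (O : Type*) [CommRing O] [IsLocalRing O] : Type _ :=
  O ⧸ IsLocalRing.maximalIdeal O

/-- The reduction `L / 𝔪 L` (that is, `L / π L`) of a lattice `L`. -/
abbrev Reduction (L : Submodule O V) : Type _ :=
  L ⧸ (IsLocalRing.maximalIdeal O • ⊤ : Submodule O L)

/-- The action of a group element on a stable lattice. -/
def stableAction (L : Submodule O V) (hL : IsStable ρ L) (g : G) : L →ₗ[O] L :=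
  ((ρ g).restrictScalars O).restrict (hL g)

/-- The induced endomorphism of `L / π L`, for a stable lattice `L`. -/
def residualAction (L : Submodule O V) (hL : IsStable ρ L) (g : G) :
    Reduction L →ₗ[O] Reduction L :=
  Submodule.mapQ (IsLocalRing.maximalIdeal O • ⊤ : Submodule O L)
    (IsLocalRing.maximalIdeal O • ⊤ : Submodule O L) (stableAction ρ L hL g)
    (by rw [← Submodule.map_le_iff_le_comap, Submodule.map_smul'']
        exact Submodule.smul_mono le_rfl le_top)

/-- The residual representation of `G` on `L / π L` over the residue field, for a stable
lattice `L`. -/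
def residualRep (L : Submodule O V) (hL : IsStable ρ L) :
    Representation (ResField O) G (Reduction L) where
  toFun g := LinearMap.extendScalarsOfSurjective (R := O) Ideal.Quotient.mk_surjective
    (residualAction ρ L hL g)
  map_one' := by
    refine LinearMap.ext fun x => ?_
    obtain ⟨y, rfl⟩ := Submodule.Quotient.mk_surjective _ x
    change Submodule.Quotient.mk (stableAction ρ L hL 1 y) = Submodule.Quotient.mk y
    congr 1
    exact Subtype.ext (by simp [stableAction])
  map_mul' g h := by
    refine LinearMap.ext fun x => ?_
    obtain ⟨y, rfl⟩ := Submodule.Quotient.mk_surjective _ x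
    change Submodule.Quotient.mk (stableAction ρ L hL (g * h) y) =
      Submodule.Quotient.mk (stableAction ρ L hL g (stableAction ρ L hL h y))
    congr 1
    exact Subtype.ext (show ρ (g * h) y.1 = ρ g (ρ h y.1) by simp)

variable (O) in
/-- `ρ̄^ss = ⨁ i, W i ^ m i`, where the `W i` are pairwise non-isomorphic irreducible
representations of `G` over the residue field: the right hand side is a semisimplification of
`L / π L`, for a stable lattice `L`. -/
def IsResidualDecomposition {r : ℕ} (W : Fin r → Type*) [∀ i, AddCommGroup (W i)]
    [∀ i, Module (ResField O)[G] (W i)] (m : Fin r → ℕ) : Prop :=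
  (∀ i, IsSimpleModule (ResField O)[G] (W i)) ∧
  (∀ i j, i ≠ j → IsEmpty (W i ≃ₗ[(ResField O)[G]] W j)) ∧
  ∃ (L : Lattice O K V) (hL : IsStable ρ L.1),
    IsSemisimplification (ResField O)[G] (residualRep ρ L.1 hL).asModule
      ((i : Fin r) → Fin (m i) → W i)

end Residual

end StableLattices

end

noncomputable section

set_option linter.unusedSectionVars false

/-! Maximal vertices are the classes of stable lattices `L` with a unique cover: the stable lattices
strictly above `L` share a vector outside `L` (`HasUniqueCover.vertex_mem_maximalVertices` and its
converse).

Lower bound (`card_le_encard_maximalVertices`). A face is a chain of steps `P i < L i` of stable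
lattices between `p M` and `M`. For `v` in `L i` but not in `P i`, Zorn's lemma gives a stable
submodule maximal among those containing `P i` and missing `v`. It is a lattice: by completeness an
unbounded submodule contains a `K`-line, and by irreducibility a stable one is then all of `V`. It
has a unique cover, and distinct steps give distinct homothety classes.

Dimension (`one_add_dim_eq_length`). A composition series of `L / p L` lifts to a chain of lattices
from `p L` to `L`, extended periodically to `D : ℤ → Submodule O V`. One period is a face with as
many vertices as there are composition factors. No face has more: as in the Jordan-Hölder theorem,
each step of a chain between `p M` and `M` adds an index at which the filtration induced by `D`
jumps, and these indices are distinct modulo the period.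

Multiplicity one (`IsPeriodicChain.exists_eq_zpow_smul`). The quotient of the unique cover of `L` by
`L` is a composition factor. If two non-homothetic lattices had the same factor, it would occur
twice in the reduction of one of them. So there are at most as many maximal vertices as factors.

Extremal vertices (`maximalVertices_subset_extremalVertices`). If `x` is interior to a segment, the
directions from `x` to its ends are opposite in an apartment. Vertices near the two ends then yield
two stable lattices strictly above a representative of `x` whose intersection is that
representative, so it has no unique cover. -/

namespace StableLattices

/-! ### Scaling submodules by units of the field -/

section Scaling

variable {O K V : Type*} [CommRing O] [Field K] [Algebra O K] [AddCommGroup V]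
  [Module K V] [Module O V] [IsScalarTower O K V]

theorem mem_units_smul_iff_exists {a : Kˣ} {L : Submodule O V} {v : V} :
    v ∈ a • L ↔ ∃ w ∈ L, a • w = v := by
  rw [Units.smul_def a L, Submodule.mem_smul_pointwise_iff_exists]
  rfl

theorem mem_units_smul {a : Kˣ} {L : Submodule O V} {v : V} : v ∈ a • L ↔ a⁻¹ • v ∈ L := by
  rw [mem_units_smul_iff_exists]
  constructor
  · rintro ⟨w, hw, rfl⟩
    simpa using hw
  · exact fun h => ⟨_, h, by simp⟩

theorem smul_mem_units_smul (a : Kˣ) {L : Submodule O V} {v : V} (hv : v ∈ L) :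
    a • v ∈ a • L :=
  mem_units_smul_iff_exists.2 ⟨v, hv, rfl⟩

theorem units_smul_mono (a : Kˣ) {L M : Submodule O V} (h : L ≤ M) : a • L ≤ a • M :=
  Submodule.map_mono h

theorem units_smul_le_units_smul {a : Kˣ} {L M : Submodule O V} : a • L ≤ a • M ↔ L ≤ M := by
  refine ⟨fun h => ?_, fun h => units_smul_mono a h⟩
  simpa using units_smul_mono a⁻¹ h

theorem units_smul_lt_units_smul {a : Kˣ} {L M : Submodule O V} : a • L < a • M ↔ L < M := by
  simp only [lt_iff_le_not_ge, units_smul_le_units_smul]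

theorem units_smul_inf (a : Kˣ) (L M : Submodule O V) : a • (L ⊓ M) = a • L ⊓ a • M := by
  ext v
  simp [mem_units_smul]

/-- The uniformiser as a unit of the fraction field. -/
def IsUniformiser (O : Type*) {K : Type*} [CommRing O] [Field K] [Algebra O K] (p : Kˣ) : Prop :=
  ∃ π : O, Irreducible π ∧ (p : K) = algebraMap O K π

theorem smul_eq_units_smul {π : O} {p : Kˣ} (hp : (p : K) = algebraMap O K π)
    (L : Submodule O V) : π • L = p • L := by
  ext v
  rw [Submodule.mem_smul_pointwise_iff_exists, mem_units_smul_iff_exists]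
  simp only [Units.smul_def, hp, algebraMap_smul]

namespace IsUniformiser

variable {p : Kˣ} (hp : IsUniformiser O p)

include hp

theorem smul_le (L : Submodule O V) : p • L ≤ L := by
  obtain ⟨π, -, h⟩ := hp
  rw [← smul_eq_units_smul h]
  exact Submodule.smul_le_self_of_tower π L

theorem pow_smul_le (n : ℕ) (L : Submodule O V) : p ^ n • L ≤ L := by
  induction n with
  | zero => simp
  | succ n ih =>
    rw [pow_succ', mul_smul]
    exact (smul_le hp _).trans ih

theorem zpow_smul_le_zpow_smul {m n : ℤ} (h : m ≤ n) (L : Submodule O V) :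
    p ^ n • L ≤ p ^ m • L := by
  obtain ⟨k, rfl⟩ := Int.le.dest h
  rw [zpow_add, mul_smul, units_smul_le_units_smul, zpow_natCast]
  exact pow_smul_le hp k L

theorem zpow_smul_le {n : ℤ} (h : 0 ≤ n) (L : Submodule O V) : p ^ n • L ≤ L := by
  simpa using zpow_smul_le_zpow_smul hp h L

theorem le_zpow_smul {n : ℤ} (h : n ≤ 0) (L : Submodule O V) : L ≤ p ^ n • L := by
  simpa using zpow_smul_le_zpow_smul hp h L

theorem zpow_smul_mem {n : ℤ} (h : 0 ≤ n) {L : Submodule O V} {v : V} (hv : v ∈ L) :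
    p ^ n • v ∈ L :=
  zpow_smul_le hp h L (smul_mem_units_smul _ hv)

theorem pow_smul_mem (n : ℕ) {L : Submodule O V} {v : V} (hv : v ∈ L) : p ^ n • v ∈ L :=
  pow_smul_le hp n L (smul_mem_units_smul _ hv)

end IsUniformiser

end Scaling

/-! ### Lattices over a discrete valuation ring -/

section DVR

variable {O K V : Type*} [CommRing O] [IsDomain O] [IsDiscreteValuationRing O] [Field K]
  [Algebra O K] [IsFractionRing O K] [AddCommGroup V]
  [Module K V] [Module O V] [IsScalarTower O K V] {p : Kˣ}

theorem exists_isUniformiser {π : O} (hπ : Irreducible π) :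
    ∃ p : Kˣ, (p : K) = algebraMap O K π ∧ IsUniformiser O p :=
  ⟨Units.mk0 _ (by simpa using hπ.ne_zero), rfl, π, hπ, rfl⟩

namespace IsUniformiser

variable (hp : IsUniformiser O p)

include hp

theorem exists_eq_zpow_smul (x : Kˣ) : ∃ (n : ℤ) (u : Oˣ), (x : K) = u • (p : K) ^ n := by
  obtain ⟨π, hπ, h⟩ := hp
  rw [h]
  exact IsDiscreteValuationRing.exists_units_eq_smul_zpow_of_irreducible hπ x.ne_zero

/-- The unit part of `a` preserves every `O`-submodule, so homothety depends only on the valuation.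
-/
theorem exists_units_smul_eq (a : Kˣ) : ∃ n : ℤ, ∀ L : Submodule O V, a • L = p ^ n • L := by
  obtain ⟨n, u, h⟩ := exists_eq_zpow_smul hp a
  refine ⟨n, fun L => ?_⟩
  have h1 : ∀ v : V, a • v = (u : O) • p ^ n • v := by
    intro v
    rw [Units.smul_def, h, Units.smul_def (p ^ n), Units.val_zpow_eq_zpow_val, Units.smul_def,
      smul_assoc]
  ext v
  rw [mem_units_smul_iff_exists]
  constructor
  · rintro ⟨w, hw, rfl⟩
    rw [h1]
    exact Submodule.smul_mem _ _ (smul_mem_units_smul _ hw)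
  · intro hv
    refine ⟨((u⁻¹ : Oˣ) : O) • p ^ (-n) • v, Submodule.smul_mem _ _ ?_, ?_⟩
    · rw [mem_units_smul] at hv
      simpa using hv
    · rw [h1, smul_comm (p ^ n), smul_smul]
      simp

theorem exists_pow_smul_mem {M : Submodule O V} (hM : Submodule.span K (M : Set V) = ⊤) (v : V) :
    ∃ n : ℕ, p ^ n • v ∈ M := by
  have hv : v ∈ Submodule.span K (M : Set V) := hM ▸ Submodule.mem_top
  induction hv using Submodule.span_induction with
  | mem x hx => exact ⟨0, by simpa using hx⟩
  | zero => exact ⟨0, by simp⟩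
  | add x y _ _ hx hy =>
    obtain ⟨m, hm⟩ := hx
    obtain ⟨n, hn⟩ := hy
    refine ⟨m + n, ?_⟩
    rw [smul_add]
    refine add_mem ?_ ?_
    · rw [add_comm, pow_add, mul_smul]; exact pow_smul_mem hp n hm
    · rw [pow_add, mul_smul]; exact pow_smul_mem hp m hn
  | smul a x _ hx =>
    obtain ⟨m, hm⟩ := hx
    rcases eq_or_ne a 0 with rfl | ha
    · exact ⟨0, by simp⟩
    · obtain ⟨n, u, h⟩ := exists_eq_zpow_smul hp (Units.mk0 a ha)
      refine ⟨m + n.natAbs, ?_⟩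
      have h2 : p ^ (m + n.natAbs) • a • x = (u : O) • p ^ (n + n.natAbs) • p ^ m • x := by
        rw [Units.val_mk0] at h
        rw [h, Units.smul_def u, smul_assoc, smul_comm _ (u : O)]
        congr 1
        rw [show (p : K) ^ n • x = p ^ n • x by rw [Units.smul_def, Units.val_zpow_eq_zpow_val],
          smul_smul, smul_smul]
        congr 1
        rw [← zpow_natCast, ← zpow_natCast, ← zpow_add, ← zpow_add]
        congr 1
        push_cast
        ring
      rw [h2]
      exact Submodule.smul_mem _ _ (zpow_smul_mem hp (by omega) hm)

theorem exists_pow_smul_le {L M : Submodule O V} (hL : L.FG)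
    (hM : Submodule.span K (M : Set V) = ⊤) : ∃ n : ℕ, p ^ n • L ≤ M := by
  obtain ⟨s, rfl⟩ := hL
  choose f hf using exists_pow_smul_mem (O := O) hp hM
  refine ⟨s.sup f, ?_⟩
  suffices h : Submodule.span O (s : Set V) ≤ (p ^ (s.sup f))⁻¹ • M by
    have := units_smul_mono (p ^ (s.sup f)) h
    simpa using this
  rw [Submodule.span_le]
  intro v hv
  rw [SetLike.mem_coe, mem_units_smul, inv_inv]
  obtain ⟨k, hk⟩ := Nat.exists_eq_add_of_le (Finset.le_sup (f := f) hv)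
  rw [hk, add_comm, pow_add, mul_smul]
  exact pow_smul_mem hp k (hf v)

/-- Krull's intersection theorem for the finitely generated module `L`. -/
theorem exists_notMem_pow_smul {L : Submodule O V} (hL : L.FG) {v : V} (hv : v ≠ 0) :
    ∃ n : ℕ, v ∉ p ^ n • L := by
  by_contra! hcon
  obtain ⟨π, hπ, h⟩ := hp
  have : Module.Finite O L := Module.Finite.iff_fg.2 hL
  have hI : Ideal.span {π} ≠ ⊤ := by
    rw [Ne, Ideal.span_singleton_eq_top]; exact hπ.not_isUnit
  have key := Ideal.iInf_pow_smul_eq_bot_of_isLocalRing (M := L) _ hI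
  have hvL : v ∈ L := by simpa using hcon 0
  have : (⟨v, hvL⟩ : L) ∈ (⨅ i : ℕ, Ideal.span {π} ^ i • ⊤ : Submodule O L) := by
    rw [Submodule.mem_iInf]
    intro n
    have h1 := hcon n
    rw [mem_units_smul_iff_exists] at h1
    obtain ⟨w, hw, hwv⟩ := h1
    rw [Ideal.span_singleton_pow, Submodule.ideal_span_singleton_smul,
      Submodule.mem_smul_pointwise_iff_exists]
    refine ⟨⟨w, hw⟩, trivial, Subtype.ext (Eq.trans ?_ hwv)⟩
    simp [Units.smul_def, h, ← map_pow]
  rw [key, Submodule.mem_bot] at this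
  exact hv (congrArg Subtype.val this)

end IsUniformiser

theorem isLattice_of_le_of_le {L M U : Submodule O V} (hL : Submodule.IsLattice K L) (hM : M.FG)
    (h : L ≤ U) (h' : U ≤ M) : Submodule.IsLattice K U := by
  have := isNoetherian_of_fg_of_noetherian M hM
  have : IsNoetherian O U := isNoetherian_of_le h'
  exact Submodule.IsLattice.of_le_of_isLattice_of_fg K h (Module.Finite.iff_fg.1 inferInstance)

end DVR

/-! ### Completeness: unbounded submodules contain lines -/

section Completeness

variable {O K V : Type*} [CommRing O] [IsDomain O] [IsDiscreteValuationRing O] [Field K]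
  [Algebra O K] [IsFractionRing O K] [AddCommGroup V]
  [Module K V] [Module O V] [IsScalarTower O K V] {p : Kˣ}

theorem maximalIdeal_smul_eq_comap {π : O} (hπ : Irreducible π) (hp : (p : K) = algebraMap O K π)
    (L : Submodule O V) :
    (IsLocalRing.maximalIdeal O • ⊤ : Submodule O L) = (p • L).comap L.subtype := by
  rw [hπ.maximalIdeal_eq, Submodule.ideal_span_singleton_smul]
  ext ⟨v, hv⟩
  rw [Submodule.mem_smul_pointwise_iff_exists, Submodule.mem_comap, mem_units_smul_iff_exists]
  simp only [Units.smul_def, hp, algebraMap_smul, Submodule.subtype_apply]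
  constructor
  · rintro ⟨⟨w, hw⟩, -, h⟩
    exact ⟨w, hw, congrArg Subtype.val h⟩
  · rintro ⟨w, hw, h⟩
    exact ⟨⟨w, hw⟩, trivial, Subtype.ext h⟩

theorem isArtinian_reduction {L : Submodule O V} (hL : L.FG) : IsArtinian O (Reduction L) := by
  have : Module.Finite O L := Module.Finite.iff_fg.2 hL
  let := Ideal.Quotient.field (IsLocalRing.maximalIdeal O)
  have : IsArtinian (ResField O) (Reduction L) := inferInstance
  exact isArtinian_of_surjective_algebraMap (R := ResField O) Ideal.Quotient.mk_surjective

/-- A descending sequence of submodules between `π L` and `L` is eventually constant. -/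
theorem IsUniformiser.exists_forall_ge_eq (hp : IsUniformiser O p) {L : Submodule O V} (hL : L.FG)
    {T : ℕ → Submodule O V} (hT : Antitone T) (h : ∀ k, p • L ≤ T k) (h' : ∀ k, T k ≤ L) :
    ∃ k, ∀ n, k ≤ n → T n = T k := by
  obtain ⟨π, hπ, hp⟩ := hp
  have := isArtinian_reduction hL
  let q := (IsLocalRing.maximalIdeal O • ⊤ : Submodule O L).mkQ
  let f : ℕ →o (Submodule O (Reduction L))ᵒᵈ :=
    ⟨fun k => OrderDual.toDual (((T k).comap L.subtype).map q),
      fun m n hmn => Submodule.map_mono (Submodule.comap_mono (hT hmn))⟩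
  obtain ⟨k, hk⟩ := IsArtinian.monotone_stabilizes f
  refine ⟨k, fun n hn => ?_⟩
  have h1 : ∀ m, ((((T m).comap L.subtype).map q).comap q).map L.subtype = T m := by
    intro m
    rw [Submodule.comap_map_eq, sup_eq_left.2, Submodule.map_comap_subtype, inf_eq_right.2 (h' m)]
    rw [Submodule.ker_mkQ, maximalIdeal_smul_eq_comap hπ hp]
    exact Submodule.comap_mono (h m)
  rw [← h1 n, ← h1 k]
  exact congrArg (fun N => (Submodule.comap q N).map L.subtype) (hk n hn).symm

theorem exists_adic_sum [IsAdicComplete (IsLocalRing.maximalIdeal O) O] {π : O}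
    (hπ : Irreducible π) (a : ℕ → O) :
    ∃ s : O, ∀ k, ∃ t, s = ∑ j ∈ Finset.range k, π ^ j * a j + π ^ k * t := by
  have hmem : ∀ (n : ℕ) (x : O), x ∈ (IsLocalRing.maximalIdeal O ^ n • ⊤ : Submodule O O) ↔
      π ^ n ∣ x := by
    intro n x
    rw [hπ.maximalIdeal_eq, Ideal.span_singleton_pow, smul_eq_mul, Ideal.mul_top,
      Ideal.mem_span_singleton]
  obtain ⟨s, hs⟩ := IsPrecomplete.prec (I := IsLocalRing.maximalIdeal O) (M := O) inferInstance
    (f := fun k => ∑ j ∈ Finset.range k, π ^ j * a j) (by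
      intro m n hmn
      rw [SModEq.comm, SModEq.sub_mem, hmem, ← Finset.sum_range_add_sum_Ico _ hmn,
        add_sub_cancel_left]
      exact Finset.dvd_sum fun j hj =>
        (pow_dvd_pow π (Finset.mem_Ico.1 hj).1).mul_right _)
  refine ⟨s, fun k => ?_⟩
  have := hs k
  rw [SModEq.comm, SModEq.sub_mem, hmem] at this
  obtain ⟨t, ht⟩ := this
  exact ⟨t, by rw [← ht]; ring⟩

/-- Convergence is recorded through the remainders `p ^ k • t`, so `V` needs no topology. The sum is
formed coordinatewise in an `O`-basis of `L`. -/
theorem IsUniformiser.exists_adic_sum [IsAdicComplete (IsLocalRing.maximalIdeal O) O]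
    (hp : IsUniformiser O p) {L : Submodule O V} (hL : Submodule.IsLattice K L) {l : ℕ → V}
    (hl : ∀ j, l j ∈ L) :
    ∃ s ∈ L, ∀ k, ∃ t ∈ L, s = ∑ j ∈ Finset.range k, p ^ j • l j + p ^ k • t := by
  obtain ⟨π, hπ, hp⟩ := hp
  let b := Module.Free.chooseBasis O L
  choose s hs using fun i => StableLattices.exists_adic_sum hπ (fun j => b.repr ⟨l j, hl j⟩ i)
  choose t ht using hs
  have hpow : ∀ (n : ℕ) (v : V), p ^ n • v = π ^ n • v := by
    intro n v
    rw [Units.smul_def, Units.val_pow_eq_pow_val, hp, ← map_pow, algebraMap_smul]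
  refine ⟨((∑ i, s i • b i : L) : V), Subtype.property _, fun k =>
    ⟨((∑ i, t i k • b i : L) : V), Subtype.property _, ?_⟩⟩
  have h1 : ∀ j, l j = ((∑ i, b.repr ⟨l j, hl j⟩ i • b i : L) : V) := fun j => by
    rw [b.sum_repr]
  simp only [hpow]
  rw [Finset.sum_congr rfl (fun j _ => congrArg (π ^ j • ·) (h1 j))]
  norm_cast
  simp only [Finset.smul_sum]
  rw [Finset.sum_comm, ← Finset.sum_add_distrib]
  refine Finset.sum_congr rfl fun i _ => ?_
  rw [ht i k, add_smul, Finset.sum_smul]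
  simp only [mul_smul]

/-- Over a complete discrete valuation ring, an unbounded submodule contains a line. -/
theorem IsUniformiser.exists_forall_mem_pow_smul [IsAdicComplete (IsLocalRing.maximalIdeal O) O]
    (hp : IsUniformiser O p) {L M : Submodule O V} (hL : Submodule.IsLattice K L)
    (hLM : L ≤ M) (hM : ∀ n : ℕ, ¬ p ^ n • M ≤ L) :
    ∃ w ≠ 0, ∀ n : ℕ, w ∈ p ^ n • M := by
  have hanti : ∀ {m n : ℕ}, m ≤ n → p ^ n • M ≤ p ^ m • M := fun {m n} h => by
    have := hp.zpow_smul_le_zpow_smul (m := m) (n := n) (by exact_mod_cast h) M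
    simpa using this
  -- Modulo `L`, these are the `p`-torsion parts of the images of `p ^ k • M`; they decrease inside
  -- the Artinian module `p⁻¹ L / L`.
  obtain ⟨k, hk⟩ := hp.exists_forall_ge_eq (L := p⁻¹ • L) (T := fun k => (p ^ k • M ⊔ L) ⊓ p⁻¹ • L)
    (Submodule.IsLattice.smul K L p⁻¹).fg
    (fun m n h => inf_le_inf_right _ (sup_le_sup_right (hanti h) _))
    (fun k => by
      rw [smul_inv_smul]
      exact le_inf le_sup_right (by simpa using hp.le_zpow_smul (n := -1) (by omega) L))
    (fun k => inf_le_right)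
  -- From the stable index on, `(p ^ k M + L) / L` is `p`-divisible. The `p`-torsion element `p ^ s
  -- x` is also `p ^ (k + s + 1) m` modulo `L`, so subtracting `p ^ (k + 1) m` from `x` lowers the
  -- order of torsion.
  have hdiv : ∀ (s : ℕ) (x : V), x ∈ p ^ k • M ⊔ L → p ^ s • x ∈ L →
      ∃ y ∈ p ^ k • M ⊔ L, ∃ z ∈ L, x = p • y + z := by
    intro s
    induction s with
    | zero => exact fun x _ hx => ⟨0, zero_mem _, x, by simpa using hx, by simp⟩
    | succ s ih =>
      intro x hx hsx
      have h1 : p ^ s • x ∈ (p ^ k • M ⊔ L) ⊓ p⁻¹ • L := by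
        refine ⟨hp.pow_smul_mem s hx, ?_⟩
        rw [SetLike.mem_coe, mem_units_smul, inv_inv, smul_smul, ← pow_succ']
        exact hsx
      rw [← hk (k + s + 1) (by omega)] at h1
      obtain ⟨u, hu, z, hz, huz⟩ := Submodule.mem_sup.1 h1.1
      obtain ⟨m, hm, rfl⟩ := mem_units_smul_iff_exists.1 hu
      have hkm : p ^ k • m ∈ p ^ k • M ⊔ L := Submodule.mem_sup_left (smul_mem_units_smul _ hm)
      obtain ⟨y, hy, z', hz', hyz⟩ := ih (x - p • p ^ k • m)
        (sub_mem hx (by simpa using hp.pow_smul_mem 1 hkm)) (by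
          rw [smul_sub, ← huz, smul_smul, smul_smul, ← pow_succ, ← pow_add,
            show s + 1 + k = k + s + 1 by ring, add_sub_cancel_left]
          exact hz)
      refine ⟨y + p ^ k • m, add_mem hy hkm, z', hz', ?_⟩
      rw [smul_add, add_right_comm, ← hyz]
      abel
  obtain ⟨m, hm, hmL⟩ := SetLike.not_le_iff_exists.1 (hM k)
  have hstep : ∀ x : (p ^ k • M ⊔ L : Submodule O V), ∃ y : (p ^ k • M ⊔ L : Submodule O V),
      ∃ z ∈ L, (x : V) = p • (y : V) + z := by
    rintro ⟨x, hx⟩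
    obtain ⟨s, hs⟩ := hp.exists_pow_smul_mem hL.span_eq_top x
    obtain ⟨y, hy, z, hz, h⟩ := hdiv s x hx hs
    exact ⟨⟨y, hy⟩, z, hz, h⟩
  choose f g hg hfg using hstep
  let y : ℕ → (p ^ k • M ⊔ L : Submodule O V) := fun n => f^[n] ⟨m, Submodule.mem_sup_left hm⟩
  have hy : ∀ n, (m : V) = p ^ n • (y n : V) + ∑ j ∈ Finset.range n, p ^ j • g (y j) := by
    intro n
    induction n with
    | zero => simp [y]
    | succ n ih =>
      have h1 : (y (n + 1) : V) = f (y n) := by simp only [y, Function.iterate_succ_apply']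
      rw [ih, Finset.sum_range_succ, h1]
      nth_rewrite 1 [hfg (y n)]
      rw [smul_add, smul_smul, ← pow_succ]
      abel
  -- Repeated division of `m` by `p` leaves errors in `L` that sum to `s`. Then `m - s` is
  -- infinitely divisible in `M`, and it is nonzero because `m` is not in `L`.
  obtain ⟨s, hs, hsum⟩ := hp.exists_adic_sum hL (fun j => hg (y j))
  refine ⟨m - s, fun h => hmL (by rw [sub_eq_zero.1 h]; exact hs), fun n => ?_⟩
  obtain ⟨t, ht, hst⟩ := hsum n
  have h2 : m - s = p ^ n • ((y n : V) - t) := by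
    rw [hy n, hst, smul_sub]
    abel
  rw [h2]
  refine smul_mem_units_smul _ (sub_mem ?_ (hLM ht))
  exact (sup_le (hp.pow_smul_le k M) hLM) (y n).2

end Completeness

/-! ### Stable lattices, unique covers and maximal vertices -/

section Stable

variable {O K V G : Type*} [CommRing O] [IsDomain O] [IsDiscreteValuationRing O] [Field K]
  [Algebra O K] [IsFractionRing O K] [AddCommGroup V] [Module K V] [FiniteDimensional K V]
  [Module O V] [IsScalarTower O K V] [Group G] {p : Kˣ} {ρ : Representation K G V}

/-- `L` is a `ρ(G)`-stable lattice. -/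
structure IsStableLattice (ρ : Representation K G V) (L : Submodule O V) : Prop where
  isLattice : Submodule.IsLattice K L
  isStable : IsStable ρ L

theorem IsStable.inf {L M : Submodule O V} (hL : IsStable ρ L) (hM : IsStable ρ M) :
    IsStable ρ (L ⊓ M) :=
  fun g v hv => ⟨hL g v hv.1, hM g v hv.2⟩

theorem IsStable.sup {L M : Submodule O V} (hL : IsStable ρ L) (hM : IsStable ρ M) :
    IsStable ρ (L ⊔ M) := by
  intro g v hv
  obtain ⟨x, hx, y, hy, rfl⟩ := Submodule.mem_sup.1 hv
  rw [map_add]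
  exact Submodule.add_mem_sup (hL g x hx) (hM g y hy)

theorem IsStable.smul {L : Submodule O V} (hL : IsStable ρ L) (a : Kˣ) : IsStable ρ (a • L) := by
  intro g v hv
  obtain ⟨w, hw, rfl⟩ := mem_units_smul_iff_exists.1 hv
  rw [show ρ g (a • w) = a • ρ g w from (ρ g).map_smul (a : K) w]
  exact smul_mem_units_smul a (hL g w hw)

namespace IsStableLattice

variable {L M : Submodule O V}

theorem inf (hL : IsStableLattice ρ L) (hM : IsStableLattice ρ M) : IsStableLattice ρ (L ⊓ M) :=
  have := hL.1
  have := hM.1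
  ⟨inferInstance, hL.2.inf hM.2⟩

theorem sup (hL : IsStableLattice ρ L) (hM : IsStableLattice ρ M) : IsStableLattice ρ (L ⊔ M) :=
  have := hL.1
  have := hM.1
  ⟨inferInstance, hL.2.sup hM.2⟩

theorem smul (hL : IsStableLattice ρ L) (a : Kˣ) : IsStableLattice ρ (a • L) :=
  have := hL.1
  ⟨inferInstance, hL.2.smul a⟩

end IsStableLattice

theorem IsUniformiser.smul_lt (hp : IsUniformiser O p) [Nontrivial V] {L : Submodule O V}
    (hL : Submodule.IsLattice K L) : p • L < L := by
  refine lt_of_le_of_ne (hp.smul_le L) fun h => ?_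
  have h1 : ∀ n : ℕ, p ^ n • L = L := by
    intro n
    induction n with
    | zero => simp
    | succ n ih => rw [pow_succ, mul_smul, h, ih]
  obtain ⟨v, hv⟩ := exists_ne (0 : V)
  obtain ⟨n, hn⟩ := hp.exists_pow_smul_mem hL.span_eq_top v
  obtain ⟨m, hm⟩ := hp.exists_notMem_pow_smul hL.fg (v := p ^ n • v) ((smul_ne_zero_iff_ne _).2 hv)
  exact hm (by rwa [h1])

theorem IsUniformiser.zpow_smul_lt_zpow_smul (hp : IsUniformiser O p) [Nontrivial V]
    {L : Submodule O V} (hL : Submodule.IsLattice K L) {m n : ℤ} (h : m < n) :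
    p ^ n • L < p ^ m • L := by
  refine (hp.zpow_smul_le_zpow_smul (Int.add_one_le_iff.2 h) L).trans_lt ?_
  rw [zpow_add, mul_smul, units_smul_lt_units_smul, zpow_one]
  exact hp.smul_lt hL

/-- The stable lattices strictly containing `L` have a vector outside `L` in common. -/
def HasUniqueCover (ρ : Representation K G V) (L : Submodule O V) : Prop :=
  ∃ v ∉ L, ∀ M : Submodule O V, IsStableLattice ρ M → L < M → v ∈ M

theorem HasUniqueCover.smul {L : Submodule O V} (h : HasUniqueCover ρ L) (a : Kˣ) :
    HasUniqueCover ρ (a • L) := by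
  obtain ⟨v, hv, h⟩ := h
  refine ⟨a • v, by simpa [mem_units_smul] using hv, fun M hM hlt => ?_⟩
  have := h (a⁻¹ • M) (hM.smul _) (by
    rw [← units_smul_lt_units_smul (a := a)]
    simpa using hlt)
  simpa [mem_units_smul] using this

theorem HasUniqueCover.lt_inf {L X Y : Submodule O V} (h : HasUniqueCover ρ L)
    (hX : IsStableLattice ρ X) (hY : IsStableLattice ρ Y) (hLX : L < X) (hLY : L < Y) :
    L < X ⊓ Y := by
  obtain ⟨v, hv, h⟩ := h
  refine lt_of_le_not_ge (le_inf hLX.le hLY.le) fun hle => hv (hle ⟨h X hX hLX, h Y hY hLY⟩)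

/-- With `v` the common vector, `L` is normalised at `p v`: the lattice `p⁻¹ L` is strictly larger,
so it contains `v`. Any stable lattice `M` strictly above `L` contains `v`, so `p v` is in `p M` and
`M` is not normalised at `p v`. -/
theorem HasUniqueCover.vertex_mem_maximalVertices (hp : IsUniformiser O p) {π : O}
    (hπp : (p : K) = algebraMap O K π) {L : Lattice O K V} (hL : IsStable ρ L.1)
    (h : HasUniqueCover ρ L.1) : L.vertex ∈ maximalVertices ρ π := by
  obtain ⟨v, hv, h⟩ := h
  have hv0 : v ≠ 0 := fun h0 => hv (h0 ▸ zero_mem _)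
  have : Nontrivial V := ⟨v, 0, hv0⟩
  have hpv : p • v ∈ L.1 := by
    have := h (p⁻¹ • L.1) (IsStableLattice.smul ⟨L.2, hL⟩ _) (by
      rw [← units_smul_lt_units_smul (a := p), smul_inv_smul]
      exact hp.smul_lt L.2)
    simpa [mem_units_smul] using this
  refine ⟨p • v, (smul_ne_zero_iff_ne _).2 hv0, L, rfl, ⟨hL, hpv, ?_⟩, ?_⟩
  · rw [smul_eq_units_smul hπp]
    simpa [mem_units_smul] using hv
  · rintro M ⟨hM, hpvM, hpvM'⟩ hLM
    by_contra hlt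
    refine hpvM' ?_
    rw [smul_eq_units_smul hπp]
    exact smul_mem_units_smul p (h M.1 ⟨M.2, hM⟩ (lt_of_le_not_ge hLM hlt))

/-- If `L` is maximal among the lattices normalised at `v`, a larger stable `M` fails to be
normalised only through `v ∈ p M`, so `p⁻¹ v` is the common vector. -/
theorem exists_hasUniqueCover_of_mem_maximalVertices {π : O}
    (hπp : (p : K) = algebraMap O K π) {x : Vertex O K V} (hx : x ∈ maximalVertices ρ π) :
    ∃ L : Lattice O K V, L.vertex = x ∧ IsStable ρ L.1 ∧ HasUniqueCover ρ L.1 := by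
  obtain ⟨v, hv, L, rfl, ⟨hL, hvL, hvL'⟩, hmax⟩ := hx
  refine ⟨L, rfl, hL, p⁻¹ • v, ?_, fun M hM hlt => ?_⟩
  · rw [smul_eq_units_smul hπp, mem_units_smul] at hvL'
    exact hvL'
  · by_contra hvM
    rw [← mem_units_smul, ← smul_eq_units_smul hπp] at hvM
    exact hlt.not_ge (hmax (y := ⟨M, hM.1⟩) ⟨hM.2, hlt.le hvL, hvM⟩ hlt.le)

variable [IsAdicComplete (IsLocalRing.maximalIdeal O) O]

theorem fg_of_isStable_of_ne_top (hp : IsUniformiser O p) (hρ : ρ.IsIrreducible)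
    {L M : Submodule O V} (hL : Submodule.IsLattice K L) (hM : IsStable ρ M) (hLM : L ≤ M)
    (hne : M ≠ ⊤) : M.FG := by
  by_cases h : ∃ n : ℕ, p ^ n • M ≤ L
  · obtain ⟨n, hn⟩ := h
    refine (isLattice_of_le_of_le (K := K) hL (M := (p ^ n)⁻¹ • L) ?_ hLM ?_).fg
    · exact (Submodule.IsLattice.smul K L _).fg
    · rw [← units_smul_le_units_smul (a := p ^ n), smul_inv_smul]
      exact hn
  · push Not at h
    obtain ⟨w, hw0, hw⟩ := hp.exists_forall_mem_pow_smul hL hLM h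
    have hz : ∀ {v : V}, (∀ n : ℕ, v ∈ p ^ n • M) → ∀ n : ℤ, v ∈ p ^ n • M := by
      intro v hv n
      have h1 := hv n.toNat
      rw [← zpow_natCast] at h1
      exact hp.zpow_smul_le_zpow_smul (by omega) M h1
    -- The infinitely divisible vectors of `M` form a `K`-subspace, stable under `G` and nonzero by
    -- completeness; irreducibility makes it `V`.
    let D : Submodule K V :=
      { carrier := {v | ∀ n : ℤ, v ∈ p ^ n • M}
        add_mem' := fun ha hb n => add_mem (ha n) (hb n)
        zero_mem' := fun n => zero_mem _
        smul_mem' := by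
          intro c v hv n
          rcases eq_or_ne c 0 with rfl | hc
          · simp
          · obtain ⟨m, hm⟩ := hp.exists_units_smul_eq (V := V) (Units.mk0 c hc)
            have h1 := smul_mem_units_smul (Units.mk0 c hc) (hv (n - m))
            rw [hm, smul_smul, ← zpow_add, add_sub_cancel] at h1
            exact h1 }
    let S : Subrepresentation ρ :=
      ⟨D, fun g v hv n => hM.smul (p ^ n) g v (hv n)⟩
    have hS : S ≠ ⊥ := by
      intro h0
      have : w ∈ S.toSubmodule := hz hw
      rw [h0] at this
      exact hw0 ((Submodule.mem_bot K).1 this)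
    have hS' : S = ⊤ := (hρ.eq_bot_or_eq_top S).resolve_left hS
    refine absurd (eq_top_iff.2 fun v _ => ?_) hne
    have hv : v ∈ S.toSubmodule := by
      rw [hS']
      exact Submodule.mem_top (R := K)
    simpa using hv 0

/-- Zorn's lemma is applied to stable submodules, not lattices, since a union of lattices need not
be a lattice. The maximal element misses `v`, so it is not `V` and is finitely generated; maximality
makes `v` the common vector. -/
theorem exists_hasUniqueCover (hp : IsUniformiser O p) (hρ : ρ.IsIrreducible) {L : Submodule O V}
    (hL : IsStableLattice ρ L) {v : V} (hv : v ∉ L) :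
    ∃ M : Submodule O V, IsStableLattice ρ M ∧ L ≤ M ∧ v ∉ M ∧ HasUniqueCover ρ M := by
  obtain ⟨M, hLM, hM⟩ := zorn_le_nonempty₀ {M : Submodule O V | IsStable ρ M ∧ L ≤ M ∧ v ∉ M} (by
      intro c hc hchain y hy
      have hmem : ∀ z, z ∈ sSup c ↔ ∃ M ∈ c, z ∈ M := fun z =>
        Submodule.mem_sSup_of_directed ⟨y, hy⟩ hchain.directedOn
      refine ⟨sSup c, ⟨fun g z hz => ?_, (hc hy).2.1.trans (le_sSup hy), fun h => ?_⟩,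
        fun z hz => le_sSup hz⟩
      · obtain ⟨M, hM, hzM⟩ := (hmem z).1 hz
        exact (hmem _).2 ⟨M, hM, (hc hM).1 g z hzM⟩
      · obtain ⟨M, hM, hvM⟩ := (hmem v).1 h
        exact (hc hM).2.2 hvM) L ⟨hL.2, le_rfl, hv⟩
  obtain ⟨⟨hMst, -, hvM⟩, hmax⟩ := hM
  have hfg : M.FG := fg_of_isStable_of_ne_top hp hρ hL.1 hMst hLM
    (fun h => hvM (h ▸ Submodule.mem_top))
  have := hL.1
  refine ⟨M, ⟨.of_le_of_isLattice_of_fg K hLM hfg, hMst⟩, hLM, hvM, v, hvM, fun X hX hlt => ?_⟩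
  by_contra hvX
  exact hlt.not_ge (hmax ⟨hX.2, hLM.trans hlt.le, hvX⟩ hlt.le)

end Stable

/-! ### Faces give maximal vertices -/

section Faces

variable {O K V G : Type*} [CommRing O] [IsDomain O] [IsDiscreteValuationRing O] [Field K]
  [Algebra O K] [IsFractionRing O K] [AddCommGroup V] [Module K V] [FiniteDimensional K V]
  [Module O V] [IsScalarTower O K V] [Group G] {p : Kˣ} {ρ : Representation K G V}

theorem vertex_eq_iff {L M : Lattice O K V} : L.vertex = M.vertex ↔ ∃ a : Kˣ, M.1 = a • L.1 :=
  Quotient.eq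

theorem vertex_eq_iff_zpow (hp : IsUniformiser O p) {L M : Lattice O K V} :
    L.vertex = M.vertex ↔ ∃ n : ℤ, M.1 = p ^ n • L.1 := by
  rw [vertex_eq_iff]
  constructor
  · rintro ⟨a, h⟩
    obtain ⟨n, hn⟩ := hp.exists_units_smul_eq (V := V) a
    exact ⟨n, h.trans (hn _)⟩
  · rintro ⟨n, h⟩
    exact ⟨_, h⟩

theorem IsStableVertex.isStable {L : Lattice O K V} (h : IsStableVertex ρ L.vertex) :
    IsStable ρ L.1 := by
  obtain ⟨M, hM, hst⟩ := h
  obtain ⟨a, ha⟩ := vertex_eq_iff.1 hM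
  rw [ha]
  exact hst.smul a

theorem card_le_of_forall_mem_iff {α : Type*} {n : ℕ} {s : Finset α} (f : Fin n → α)
    (hs : ∀ x, x ∈ s ↔ ∃ i, f i = x) : s.card ≤ n := by
  classical
  have : s = Finset.univ.image f := by
    ext x
    simp [hs]
  rw [this]
  simpa using Finset.card_image_le (s := Finset.univ) (f := f)

/-- A simplex of the invariant complex is a chain of successive inclusions `P i < L i` of stable
lattices between `p M` and `M`. -/
theorem exists_chain_of_mem_faces {π : O} (hπp : (p : K) = algebraMap O K π)
    {s : Finset (Vertex O K V)} (hs : s ∈ (invariantComplex (O := O) ρ π).faces) :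
    ∃ (n : ℕ) (P L : Fin n → Submodule O V) (M : Submodule O V), s.card ≤ n ∧
      (∀ i, IsStableLattice ρ (P i)) ∧ (∀ i, IsStableLattice ρ (L i)) ∧
      (∀ i, P i < L i) ∧ (∀ i, p • M ≤ P i) ∧ (∀ i, L i ≤ M) ∧ ∀ i j, i < j → L i ≤ P j := by
  obtain ⟨⟨n, L, hL, hlt, hsL⟩, hst⟩ := hs
  have hLst : ∀ i, IsStableLattice ρ (L i).1 := fun i =>
    ⟨(L i).2, (hst _ ((hsL _).2 ⟨i, rfl⟩)).isStable⟩
  rw [smul_eq_units_smul hπp] at hlt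
  -- The predecessor of each lattice in the cyclic chain; the first one is preceded by `p` times the
  -- last.
  let P : Fin (n + 1) → Submodule O V :=
    Fin.cases (p • (L (Fin.last n)).1) (fun i : Fin n => (L i.castSucc).1)
  refine ⟨n + 1, P, fun i => (L i).1, (L (Fin.last n)).1, card_le_of_forall_mem_iff _ hsL, ?_,
    hLst, ?_, ?_, fun i => hL.monotone (Fin.le_last i), ?_⟩
  · intro i
    induction i using Fin.cases with
    | zero => exact (hLst _).smul p
    | succ i => exact hLst _
  · intro i
    induction i using Fin.cases with
    | zero => exact hlt
    | succ i => exact hL (Fin.castSucc_lt_succ)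
  · intro i
    induction i using Fin.cases with
    | zero => exact le_rfl
    | succ i => exact hlt.le.trans (hL.monotone (Fin.zero_le _))
  · intro i j hij
    induction j using Fin.cases with
    | zero => exact absurd hij (Fin.not_lt_zero _)
    | succ j => exact hL.monotone (Fin.le_castSucc_iff.2 hij)

variable [IsAdicComplete (IsLocalRing.maximalIdeal O) O]

theorem card_le_encard_maximalVertices (hp : IsUniformiser O p) {π : O}
    (hπp : (p : K) = algebraMap O K π) (hρ : ρ.IsIrreducible) {s : Finset (Vertex O K V)}
    (hs : s ∈ (invariantComplex (O := O) ρ π).faces) :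
    (s.card : ℕ∞) ≤ (maximalVertices (O := O) ρ π).encard := by
  obtain ⟨n, P, L, T, hcard, hP, -, hPL, hPle, hLle, hLP⟩ := exists_chain_of_mem_faces hπp hs
  have hex : ∀ i, ∃ M : Lattice O K V, IsStable ρ M.1 ∧ P i ≤ M.1 ∧ ¬ L i ≤ M.1 ∧
      HasUniqueCover ρ M.1 := by
    intro i
    obtain ⟨v, hvL, hvP⟩ := SetLike.exists_of_lt (hPL i)
    obtain ⟨M, hM, hPM, hvM, hc⟩ := exists_hasUniqueCover hp hρ (hP i) hvP
    exact ⟨⟨M, hM.1⟩, hM.2, hPM, fun h => hvM (h hvL), hc⟩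
  choose M hM hPM hLM hc using hex
  -- Suppose `M j = p ^ k M i`. For `k ≥ 0`, `L i ≤ P j ≤ M j ≤ M i`. For `k < 0`, `L j ≤ T ≤ p⁻¹ P
  -- i ≤ p⁻¹ M i ≤ M j`. Both are excluded.
  have hne : ∀ i j, i < j → (M i).vertex ≠ (M j).vertex := by
    intro i j hij h
    obtain ⟨k, hk⟩ := (vertex_eq_iff_zpow hp).1 h
    have hk0 : k < 0 := by
      by_contra! hk0
      refine hLM i ((hLP i j hij).trans ((hPM j).trans ?_))
      rw [hk]
      exact hp.zpow_smul_le hk0 _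
    refine hLM j ?_
    rw [hk]
    refine (hLle j).trans ?_
    have h1 : T ≤ p ^ (-1 : ℤ) • (M i).1 := by
      rw [← units_smul_le_units_smul (a := p), zpow_neg_one, smul_inv_smul]
      exact (hPle i).trans (hPM i)
    exact h1.trans (hp.zpow_smul_le_zpow_smul (by omega) _)
  have hinj : Function.Injective fun i => (M i).vertex := by
    intro i j h
    by_contra hij
    rcases lt_or_gt_of_ne hij with h1 | h1
    · exact hne i j h1 h
    · exact hne j i h1 h.symm
  calc (s.card : ℕ∞) ≤ (n : ℕ∞) := by exact_mod_cast hcard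
    _ = (Set.range fun i => (M i).vertex).encard := by
        rw [← Set.image_univ, hinj.encard_image, Set.encard_univ]
        simp
    _ ≤ _ := by
        refine Set.encard_le_encard ?_
        rintro _ ⟨i, rfl⟩
        exact (hc i).vertex_mem_maximalVertices hp hπp (hM i)

end Faces

/-! ### Dimension and the size of faces -/

section Dim

variable {α : Type*}

theorem one_add_dim_le {X : PreAbstractSimplicialComplex α} {c : ℕ∞} (hX : X.faces.Nonempty)
    (h : ∀ s ∈ X.faces, (s.card : ℕ∞) ≤ c) : 1 + dim X ≤ c := by
  have hcard : ∀ s ∈ X.faces, 1 ≤ s.card := fun s hs => (X.isRelLowerSet_faces hs).1.card_pos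
  induction c using ENat.recTopCoe with
  | top => exact le_top
  | coe c =>
    have h' : ∀ s ∈ X.faces, s.card ≤ c := fun s hs => by exact_mod_cast h s hs
    have h1 : dim X ≤ ((c - 1 : ℕ) : ℕ∞) :=
      iSup₂_le fun s hs => by exact_mod_cast Nat.sub_le_sub_right (h' s hs) 1
    obtain ⟨s, hs⟩ := hX
    have hc : 1 ≤ c := (hcard s hs).trans (h' s hs)
    calc 1 + dim X ≤ 1 + ((c - 1 : ℕ) : ℕ∞) := by gcongr
      _ = ((1 + (c - 1) : ℕ) : ℕ∞) := by push_cast; rfl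
      _ = c := by rw [Nat.add_sub_cancel' hc]

theorem le_one_add_dim {X : PreAbstractSimplicialComplex α} {s : Finset α} (hs : s ∈ X.faces) :
    (s.card : ℕ∞) ≤ 1 + dim X := by
  have h : ((s.card - 1 : ℕ) : ℕ∞) ≤ dim X := le_iSup₂_of_le s hs le_rfl
  calc (s.card : ℕ∞) = ((1 + (s.card - 1) : ℕ) : ℕ∞) := by
        rw [Nat.add_sub_cancel' (X.isRelLowerSet_faces hs).1.card_pos]
    _ = 1 + ((s.card - 1 : ℕ) : ℕ∞) := by push_cast; rfl
    _ ≤ _ := by gcongr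

end Dim

/-! ### Indices of maximal exponents on a simplex -/

section ArgMax

variable {ι U : Type*} [Finite ι]

/-- The maximum of `n' + k` is that of `n`, which gives the first inclusion, or one more, which
gives the second. -/
theorem argmax_subset_or_subset [Nonempty ι] {n n' : ι → ℤ} {k : ℤ} (h : ∀ i, n i ≤ n' i + k)
    (h' : ∀ i, n' i + k ≤ n i + 1) :
    {i | ∀ j, n j ≤ n i} ⊆ {i | ∀ j, n' j ≤ n' i} ∨
      {i | ∀ j, n' j ≤ n' i} ⊆ {i | ∀ j, n j ≤ n i} := by
  obtain ⟨i₀, h₀⟩ := Finite.exists_max n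
  obtain ⟨i₁, h₁⟩ := Finite.exists_max n'
  have e1 := h i₀
  have e2 := h₁ i₀
  have e3 := h' i₁
  have e4 := h₀ i₁
  rcases eq_or_ne (n' i₁ + k) (n i₀) with h2 | h2
  · refine Or.inl fun i hi j => ?_
    have := hi i₀
    have := h i
    have := h₁ j
    omega
  · refine Or.inr fun i hi j => ?_
    have := hi i₁
    have := h' i
    have := h₀ j
    omega

/-- On a simplex, one of the vertices attains its maximal exponents in the same directions as
an interior point. -/
theorem exists_argmax_iff [Nonempty ι] {s : Finset U} (hs : s.Nonempty) {w : U → ℝ}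
    (hw : ∀ u ∈ s, 0 < w u) {n : U → ι → ℤ}
    (hn : ∀ u ∈ s, ∀ u' ∈ s, ∃ k : ℤ, ∀ i, n u i ≤ n u' i + k ∧ n u' i + k ≤ n u i + 1) :
    ∃ u ∈ s, (∀ u' ∈ s, ∀ i, (∀ j, n u j ≤ n u i) → ∀ j, n u' j ≤ n u' i) ∧
      ∀ i, (∀ j, n u j ≤ n u i) ↔
        ∀ j, ∑ u' ∈ s, w u' * (n u' j : ℝ) ≤ ∑ u' ∈ s, w u' * (n u' i : ℝ) := by
  -- The sets of maximising indices are nested, so a smallest one lies in all the others and is the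
  -- maximising set of any positive combination.
  obtain ⟨u, hu, hmin⟩ := s.exists_min_image (fun u => {i | ∀ j, n u j ≤ n u i}.ncard) hs
  have hsub : ∀ u' ∈ s, ∀ i, (∀ j, n u j ≤ n u i) → ∀ j, n u' j ≤ n u' i := by
    intro u' hu'
    obtain ⟨k, hk⟩ := hn u hu u' hu'
    rcases argmax_subset_or_subset (fun i => (hk i).1) (fun i => (hk i).2) with h | h
    · exact h
    · exact (Set.eq_of_subset_of_ncard_le h (hmin u' hu')).symm.le
  have hle : ∀ i, (∀ j, n u j ≤ n u i) → ∀ j, ∀ u' ∈ s,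
      w u' * (n u' j : ℝ) ≤ w u' * (n u' i : ℝ) := fun i hi j u' hu' =>
    mul_le_mul_of_nonneg_left (by exact_mod_cast hsub u' hu' i hi j) (hw u' hu').le
  refine ⟨u, hu, hsub, fun i => ⟨fun hi j => Finset.sum_le_sum (hle i hi j), fun hi => ?_⟩⟩
  obtain ⟨i₀, h₀⟩ := Finite.exists_max (n u)
  by_contra! hcon
  obtain ⟨j, hj⟩ := hcon
  refine (hi i₀).not_gt (Finset.sum_lt_sum (hle i₀ h₀ i) ⟨u, hu, ?_⟩)
  exact mul_lt_mul_of_pos_left (by exact_mod_cast hj.trans_le (h₀ j)) (hw u hu)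

end ArgMax

/-! ### Lattices of an apartment -/

section Apartment

variable {O K V : Type*} [CommRing O] [IsDomain O] [IsDiscreteValuationRing O] [Field K]
  [Algebra O K] [IsFractionRing O K] [AddCommGroup V] [Module K V]
  [Module O V] [IsScalarTower O K V] {p : Kˣ} {ι : Type*}

/-- The lattice spanned by `p ^ nᵢ bᵢ`, described by coordinates. -/
def apartmentLattice (O : Type*) [CommRing O] [Algebra O K] [Module O V] [IsScalarTower O K V]
    (p : Kˣ) (b : Module.Basis ι K V) (n : ι → ℤ) : Submodule O V :=
  ⨅ i, (p ^ n i • (1 : Submodule O K)).comap ((b.coord i).restrictScalars O)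

variable {b : Module.Basis ι K V} {n n' : ι → ℤ}

theorem mem_apartmentLattice {v : V} :
    v ∈ apartmentLattice O p b n ↔ ∀ i, b.repr v i ∈ p ^ n i • (1 : Submodule O K) := by
  simp [apartmentLattice, Submodule.mem_iInf]

theorem apartmentLattice_eq_span [Finite ι] :
    apartmentLattice O p b n = Submodule.span O (Set.range fun i => (p : K) ^ n i • b i) := by
  classical
  have := Fintype.ofFinite ι
  apply le_antisymm
  · intro v hv
    rw [mem_apartmentLattice] at hv
    rw [← b.sum_repr v]
    refine Submodule.sum_mem _ fun i _ => ?_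
    obtain ⟨x, hx, ho⟩ := mem_units_smul_iff_exists.1 (hv i)
    obtain ⟨o, rfl⟩ := Submodule.mem_one.1 hx
    rw [← ho, Units.smul_def, Units.val_zpow_eq_zpow_val, smul_eq_mul, mul_comm, mul_smul,
      algebraMap_smul]
    exact Submodule.smul_mem _ _ (Submodule.subset_span ⟨i, rfl⟩)
  · rw [Submodule.span_le]
    rintro _ ⟨i, rfl⟩
    rw [SetLike.mem_coe, mem_apartmentLattice]
    intro j
    rw [map_smul, Finsupp.smul_apply, b.repr_self, Finsupp.single_apply]
    split_ifs with h
    · subst h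
      exact mem_units_smul_iff_exists.2 ⟨1, Submodule.one_le.1 le_rfl, by
        rw [Units.smul_def, Units.val_zpow_eq_zpow_val]⟩
    · simp

theorem zpow_smul_apartmentLattice (k : ℤ) :
    p ^ k • apartmentLattice O p b n = apartmentLattice O p b (fun i => n i + k) := by
  ext v
  rw [mem_units_smul, mem_apartmentLattice, mem_apartmentLattice]
  refine forall_congr' fun i => ?_
  have h : b.repr ((p ^ k)⁻¹ • v) i = (p ^ k)⁻¹ • b.repr v i := by
    rw [Units.smul_def, map_smul]
    rfl
  rw [h, ← mem_units_smul, smul_smul, ← zpow_add, add_comm]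

namespace IsUniformiser

variable (hp : IsUniformiser O p)
include hp

theorem zpow_smul_one_le_iff {k l : ℤ} :
    p ^ k • (1 : Submodule O K) ≤ p ^ l • (1 : Submodule O K) ↔ l ≤ k := by
  refine ⟨fun h => ?_, fun h => hp.zpow_smul_le_zpow_smul h _⟩
  by_contra! hlt
  have hL : Submodule.IsLattice K (1 : Submodule O K) :=
    ⟨⟨{1}, by simp [Submodule.one_eq_span]⟩, by
      rw [eq_top_iff]
      intro x _
      rw [← mul_one x, ← smul_eq_mul]
      exact Submodule.smul_mem _ _ (Submodule.subset_span (Submodule.one_le.1 le_rfl))⟩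
  exact (hp.zpow_smul_lt_zpow_smul hL hlt).not_ge h

theorem zpow_smul_basis_mem_iff (i : ι) (k : ℤ) :
    p ^ k • b i ∈ apartmentLattice O p b n ↔ n i ≤ k := by
  classical
  rw [← hp.zpow_smul_one_le_iff, mem_apartmentLattice]
  have h : ∀ j, b.repr (p ^ k • b i) j = p ^ k • b.repr (b i) j := by
    intro j
    rw [Units.smul_def, map_smul]
    rfl
  simp only [h, b.repr_self, Finsupp.single_apply]
  constructor
  · intro hk v hv
    obtain ⟨x, hx, rfl⟩ := mem_units_smul_iff_exists.1 hv
    obtain ⟨o, rfl⟩ := Submodule.mem_one.1 hx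
    have h1 := Submodule.smul_mem _ o (hk i)
    rw [if_pos rfl] at h1
    convert h1 using 1
    simp [Units.smul_def, Algebra.smul_def, mul_comm]
  · intro hk j
    split_ifs with hij
    · subst hij
      exact hk (smul_mem_units_smul _ (Submodule.one_le.1 le_rfl))
    · simp

theorem apartmentLattice_le_iff :
    apartmentLattice O p b n ≤ apartmentLattice O p b n' ↔ ∀ i, n' i ≤ n i := by
  constructor
  · intro h i
    exact (hp.zpow_smul_basis_mem_iff i (n i)).1
      (h ((hp.zpow_smul_basis_mem_iff i (n i)).2 le_rfl))
  · intro h v hv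
    rw [mem_apartmentLattice] at hv ⊢
    exact fun i => hp.zpow_smul_one_le_iff.2 (h i) (hv i)

theorem apartmentLattice_inf_le {m : ι → ℤ} (h : ∀ i, m i ≤ n i ∨ m i ≤ n' i) :
    apartmentLattice O p b n ⊓ apartmentLattice O p b n' ≤ apartmentLattice O p b m := by
  rintro v ⟨hv, hv'⟩
  rw [SetLike.mem_coe, mem_apartmentLattice] at hv hv'
  rw [mem_apartmentLattice]
  intro i
  rcases h i with hi | hi
  · exact hp.zpow_smul_one_le_iff.2 hi (hv i)
  · exact hp.zpow_smul_one_le_iff.2 hi (hv' i)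

end IsUniformiser

end Apartment

/-! ### Maximal vertices are extremal -/

section Extremal

variable {O K V G : Type*} [CommRing O] [IsDomain O] [IsDiscreteValuationRing O] [Field K]
  [Algebra O K] [IsFractionRing O K] [AddCommGroup V] [Module K V] [FiniteDimensional K V]
  [Module O V] [IsScalarTower O K V] [Group G] {p : Kˣ} {ρ : Representation K G V}
  {ι : Type*} {b : Module.Basis ι K V}

theorem HasExponents.exists_eq_apartmentLattice [Finite ι] {π : O}
    (hπp : (p : K) = algebraMap O K π) {x : Vertex O K V} {n : ι → ℤ}
    (h : HasExponents π b x n) :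
    ∃ L : Lattice O K V, L.vertex = x ∧ L.1 = apartmentLattice O p b n := by
  obtain ⟨L, hL, h⟩ := h
  exact ⟨L, hL, by rw [h, apartmentLattice_eq_span, hπp]⟩

theorem HasExponents.eq_of_forall_eq_add [Finite ι] (hp : IsUniformiser O p) {π : O}
    (hπp : (p : K) = algebraMap O K π) {x y : Vertex O K V} {m n : ι → ℤ}
    (hx : HasExponents π b x m) (hy : HasExponents π b y n) {k : ℤ}
    (h : ∀ i, n i = m i + k) : y = x := by
  obtain ⟨L, rfl, hL⟩ := hx.exists_eq_apartmentLattice hπp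
  obtain ⟨M, rfl, hM⟩ := hy.exists_eq_apartmentLattice hπp
  rw [eq_comm, vertex_eq_iff_zpow hp]
  exact ⟨k, by rw [hM, hL, zpow_smul_apartmentLattice, funext h]⟩

theorem IsStableVertex.isStableLattice_apartmentLattice [Finite ι] {π : O}
    (hπp : (p : K) = algebraMap O K π) {x : Vertex O K V} {n : ι → ℤ}
    (hx : IsStableVertex ρ x) (h : HasExponents π b x n) :
    IsStableLattice ρ (apartmentLattice O p b n) := by
  obtain ⟨L, rfl, hL⟩ := h.exists_eq_apartmentLattice hπp
  exact hL ▸ ⟨L.2, hx.isStable⟩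

theorem exponents_adjacent [Finite ι] (hp : IsUniformiser O p) {π : O}
    (hπp : (p : K) = algebraMap O K π) {s : Finset (Vertex O K V)}
    (hs : s ∈ (building π : PreAbstractSimplicialComplex (Vertex O K V)).faces)
    {x y : Vertex O K V} (hx : x ∈ s) (hy : y ∈ s) {m n : ι → ℤ}
    (hm : HasExponents π b x m) (hn : HasExponents π b y n) :
    ∃ k : ℤ, ∀ i, m i ≤ n i + k ∧ n i + k ≤ m i + 1 := by
  obtain ⟨d, L, hL, hlt, hsL⟩ := hs
  rw [smul_eq_units_smul hπp] at hlt
  obtain ⟨i, rfl⟩ := (hsL x).1 hx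
  obtain ⟨j, rfl⟩ := (hsL y).1 hy
  obtain ⟨M, hMv, hM⟩ := hm.exists_eq_apartmentLattice hπp
  obtain ⟨N, hNv, hN⟩ := hn.exists_eq_apartmentLattice hπp
  obtain ⟨k, hk⟩ := (vertex_eq_iff_zpow hp).1 hMv
  obtain ⟨l, hl⟩ := (vertex_eq_iff_zpow hp).1 hNv
  rw [hM, zpow_smul_apartmentLattice] at hk
  rw [hN, zpow_smul_apartmentLattice] at hl
  have hpL : ∀ i j, p ^ (1 : ℤ) • (L i).1 ≤ (L j).1 := fun i j =>
    (zpow_one p).symm ▸ (units_smul_mono p (hL.monotone (Fin.le_last i))).trans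
      (hlt.le.trans (hL.monotone (Fin.zero_le j)))
  have h1 := hpL i j
  have h2 := hpL j i
  rw [hk, hl, zpow_smul_apartmentLattice, hp.apartmentLattice_le_iff] at h1 h2
  rcases le_total i j with h | h
  · have h3 := hL.monotone h
    simp only [hk, hl] at h3
    rw [hp.apartmentLattice_le_iff] at h3
    -- Here `L i ≤ L j`, and the extra `1` replaces `L j` by `p L j`, which lies below `L i`.
    refine ⟨l - k + 1, fun i => ?_⟩
    have := h1 i
    have := h2 i
    have := h3 i
    constructor <;> linarith
  · have h3 := hL.monotone h
    simp only [hk, hl] at h3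
    rw [hp.apartmentLattice_le_iff] at h3
    refine ⟨l - k, fun i => ?_⟩
    have := h1 i
    have := h2 i
    have := h3 i
    constructor <;> linarith

theorem eq_single_of_mem_realisation {α : Type*} {X : PreAbstractSimplicialComplex α} {y : α →₀ ℝ}
    (hy : y ∈ realisation X) {x : α} (h : ∀ u ∈ y.support, u = x) : Finsupp.single x 1 = y := by
  classical
  obtain ⟨-, -, hsum⟩ := hy
  have hy : y = Finsupp.single x (y x) := by
    ext u
    rcases eq_or_ne u x with rfl | hu
    · simp
    · rw [Finsupp.single_eq_of_ne hu]
      by_contra hne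
      exact hu (h u (Finsupp.mem_support_iff.2 hne))
  rw [hy, Finsupp.sum_single_index rfl] at hsum
  rw [hy, hsum]

/-- Let `E` be the lattice with the exponents `μ` of `x`. If `x` is strictly between `y` and `z`,
the coordinates of `y` relative to `μ` are largest exactly where those of `z` are smallest, on a
proper nonempty set `A` of indices. Suitable vertices of the simplices of `y` and `z` give stable
lattices with exponents `μ + 1` on `A` and `μ` elsewhere, and the reverse. Both are strictly above
`p E` and meet in `p E`, against the unique cover. -/
theorem maximalVertices_subset_extremalVertices (hp : IsUniformiser O p) {π : O}
    (hπp : (p : K) = algebraMap O K π) :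
    maximalVertices (O := O) ρ π ⊆ extremalVertices (O := O) ρ π := by
  intro x hx
  obtain ⟨Λ, hΛx, hΛ, hcov⟩ := exists_hasUniqueCover_of_mem_maximalVertices hπp hx
  refine ⟨⟨Λ, hΛx, hΛ⟩, ?_⟩
  rintro y hy z hz ⟨b, a, a', t, ht0, ht1, ⟨n, hn, c, ha⟩, ⟨n', hn', c', ha'⟩, m, hm, c'', hm'⟩
  by_contra! hne
  replace hm := hm x (by simp)
  simp only [Finsupp.sum_single_index (h := fun u (w : ℝ) => w * (m u _ : ℝ)) (zero_mul _),
    one_mul] at hm'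
  set μ := m x with hμ
  have : Nonempty (Fin (Module.finrank K V)) := by
    by_contra hemp
    have := not_nonempty_iff.1 hemp
    exact hne.1 (eq_single_of_mem_realisation hy fun u hu =>
      hm.eq_of_forall_eq_add hp hπp (hn u hu) (k := 0) fun i => isEmptyElim i)
  have hsum : ∀ (q : Vertex O K V →₀ ℝ), q ∈ realisation (invariantComplex (O := O) ρ π) →
      ∀ (r : Vertex O K V → Fin (Module.finrank K V) → ℤ) i,
      ∑ u ∈ q.support, q u * ((r u i - μ i : ℤ) : ℝ) = (q.sum fun u w => w * (r u i : ℝ)) - μ i := by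
    intro q hq r i
    have h1 : ∑ u ∈ q.support, q u = 1 := hq.2.2
    simp only [Int.cast_sub, mul_sub, Finset.sum_sub_distrib, ← Finset.sum_mul, h1, one_mul]
    rfl
  have hpos : ∀ (q : Vertex O K V →₀ ℝ), q ∈ realisation (invariantComplex (O := O) ρ π) →
      ∀ u ∈ q.support, 0 < q u := fun q hq u hu =>
    lt_of_le_of_ne (hq.1 u) (Finsupp.mem_support_iff.1 hu).symm
  obtain ⟨u, hu, hsub, hmax⟩ := exists_argmax_iff (s := y.support) (w := y)
    (n := fun u i => n u i - μ i) ((invariantComplex (O := O) ρ π).isRelLowerSet_faces hy.2.1).1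
    (hpos y hy) (by
      intro u hu u' hu'
      obtain ⟨k, hk⟩ := exponents_adjacent hp hπp hy.2.1.1 hu hu' (hn u hu) (hn u' hu')
      exact ⟨k, fun i => ⟨by linarith [(hk i).1], by linarith [(hk i).2]⟩⟩)
  -- The signs are reversed: for `z` the indices of minimal relative exponent are needed.
  obtain ⟨u', hu', hsub', hmax'⟩ := exists_argmax_iff (s := z.support) (w := z)
    (n := fun u i => -(n' u i - μ i)) ((invariantComplex (O := O) ρ π).isRelLowerSet_faces hz.2.1).1
    (hpos z hz) (by
      intro u hu u' hu'
      obtain ⟨k, hk⟩ := exponents_adjacent hp hπp hz.2.1.1 hu hu' (hn' u hu) (hn' u' hu')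
      exact ⟨1 - k, fun i => ⟨by linarith [(hk i).2], by linarith [(hk i).1]⟩⟩)
  simp only [Int.cast_neg, mul_neg, Finset.sum_neg_distrib, neg_le_neg_iff] at hmax' hsub'
  simp only [hsum y hy, hsum z hz] at hmax hmax'
  have hlin : ∀ i, (1 - t) * ((y.sum fun u w => w * (n u i : ℝ)) - μ i) +
      t * ((z.sum fun u w => w * (n' u i : ℝ)) - μ i) = c'' - (1 - t) * c - t * c' := by
    intro i
    have h1 := hm' i
    rw [ha i, ha' i] at h1
    linarith
  set α : Fin (Module.finrank K V) → ℝ := fun i => (y.sum fun u w => w * (n u i : ℝ)) - μ i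
  set β : Fin (Module.finrank K V) → ℝ := fun i => (z.sum fun u w => w * (n' u i : ℝ)) - μ i
  -- If `A` were everything, every vertex of the simplex of `y` would have exponents `μ` plus a
  -- constant, and `y` would equal `x`.
  have hy' : ∃ i, ¬ ∀ j, n u j - μ j ≤ n u i - μ i := by
    by_contra! hall
    refine hne.1 (eq_single_of_mem_realisation hy fun v hv => ?_)
    let i₀ := Classical.arbitrary (Fin (Module.finrank K V))
    refine hm.eq_of_forall_eq_add hp hπp (hn v hv) (k := n v i₀ - μ i₀) fun i => ?_
    have h1 := hsub v hv i (hall i) i₀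
    have h2 := hsub v hv i₀ (hall i₀) i
    linarith
  have hz' : ∃ i, ¬ ∀ j, n' u' i - μ i ≤ n' u' j - μ j := by
    by_contra! hall
    refine hne.2 (eq_single_of_mem_realisation hz fun v hv => ?_)
    let i₀ := Classical.arbitrary (Fin (Module.finrank K V))
    refine hm.eq_of_forall_eq_add hp hπp (hn' v hv) (k := n' v i₀ - μ i₀) fun i => ?_
    have h1 := hsub' v hv i (hall i) i₀
    have h2 := hsub' v hv i₀ (hall i₀) i
    linarith
  have ht0' : t ≠ 0 := by
    rintro rfl
    obtain ⟨i, hi⟩ := hy'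
    refine hi ((hmax i).2 fun j => ?_)
    have h1 := hlin i
    have h2 := hlin j
    linarith
  have ht1' : t ≠ 1 := by
    rintro rfl
    obtain ⟨i, hi⟩ := hz'
    refine hi ((hmax' i).2 fun j => ?_)
    have h1 := hlin i
    have h2 := hlin j
    linarith
  have hAB : ∀ i, (∀ j, n u j - μ j ≤ n u i - μ i) ↔ ∀ j, n' u' i - μ i ≤ n' u' j - μ j := by
    intro i
    rw [hmax, hmax']
    refine forall_congr' fun j => ?_
    have h1 := hlin i
    have h2 := hlin j
    have h3 : (1 - t) * (α i - α j) = t * (β j - β i) := by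
      linarith
    have h4 : 0 < 1 - t := by
      rcases lt_or_eq_of_le ht1 with h | h
      · linarith
      · exact absurd h ht1'
    have h5 : 0 < t := lt_of_le_of_ne ht0 ht0'.symm
    have h6 : 0 ≤ (1 - t) * (α i - α j) ↔ 0 ≤ α i - α j := mul_nonneg_iff_of_pos_left h4
    rw [h3, mul_nonneg_iff_of_pos_left h5, sub_nonneg, sub_nonneg] at h6
    exact h6.symm
  obtain ⟨i₀, h₀⟩ := Finite.exists_max fun i => n u i - μ i
  have h₀' := (hAB i₀).1 h₀
  obtain ⟨i₁, h₁⟩ := hy'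
  have hE := IsStableVertex.isStableLattice_apartmentLattice (ρ := ρ) hπp
    ⟨Λ, hΛx, hΛ⟩ hm
  have hEu := (hy.2.1.2 u hu).isStableLattice_apartmentLattice hπp (hn u hu)
  have hEu' := (hz.2.1.2 u' hu').isStableLattice_apartmentLattice hπp (hn' u' hu')
  have hcov' : HasUniqueCover ρ (apartmentLattice O p b fun i => μ i + 1) := by
    obtain ⟨L, hL, hLE⟩ := hm.exists_eq_apartmentLattice hπp
    obtain ⟨k, hk⟩ := (vertex_eq_iff_zpow hp).1 (hΛx.trans hL.symm)
    rw [← zpow_smul_apartmentLattice (n := μ), ← hLE, hk]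
    exact (hcov.smul _).smul _
  set D := n u i₀ - μ i₀ with hD
  set D' := n' u' i₀ - μ i₀ with hD'
  -- Since `D` is the maximum of `n u - μ`, attained on `A`, the shift by `1 - D` gives `μ + 1` on
  -- `A` and at most `μ` off it; the intersection raises the latter to `μ`.
  have hX : IsStableLattice ρ (apartmentLattice O p b μ ⊓
      apartmentLattice O p b fun i => n u i + (1 - D)) := by
    rw [← zpow_smul_apartmentLattice]
    exact hE.inf (hEu.smul _)
  -- Dually, the shift by `-D'` gives `μ` on `A` and at least `μ + 1` off it; the sum lowers the
  -- latter to `μ + 1`.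
  have hY : IsStableLattice ρ ((apartmentLattice O p b fun i => μ i + 1) ⊔
      apartmentLattice O p b fun i => n' u' i + (-D')) := by
    rw [← zpow_smul_apartmentLattice, ← zpow_smul_apartmentLattice]
    exact (hE.smul _).sup (hEu'.smul _)
  refine (hcov'.lt_inf hX hY ?_ ?_).not_ge ?_
  · refine lt_of_le_of_ne (le_inf ?_ ?_) fun h => ?_
    · rw [hp.apartmentLattice_le_iff]
      intro i
      linarith
    · rw [hp.apartmentLattice_le_iff]
      intro i
      linarith [h₀ i]
    · have h1 : p ^ μ i₁ • b i₁ ∈ apartmentLattice O p b fun i => μ i + 1 := by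
        rw [h]
        refine ⟨(hp.zpow_smul_basis_mem_iff _ _).2 le_rfl, (hp.zpow_smul_basis_mem_iff _ _).2 ?_⟩
        push Not at h₁
        obtain ⟨j, hj⟩ := h₁
        have := h₀ j
        omega
      rw [hp.zpow_smul_basis_mem_iff] at h1
      omega
  · refine lt_of_le_of_ne le_sup_left fun h => ?_
    have h1 : p ^ μ i₀ • b i₀ ∈ apartmentLattice O p b fun i => μ i + 1 := by
      rw [h]
      exact Submodule.mem_sup_right ((hp.zpow_smul_basis_mem_iff _ _).2 (by omega))
    rw [hp.zpow_smul_basis_mem_iff] at h1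
    omega
  · classical
    have hY' : (apartmentLattice O p b fun i => μ i + 1) ⊔
        (apartmentLattice O p b fun i => n' u' i + (-D')) ≤
        apartmentLattice O p b fun i => if n u i - μ i = D then μ i else μ i + 1 := by
      refine sup_le ?_ ?_
      · rw [hp.apartmentLattice_le_iff]
        intro i
        split_ifs <;> linarith
      · rw [hp.apartmentLattice_le_iff]
        intro i
        have h1 := h₀' i
        split_ifs with h
        · linarith
        · have h2 : ¬ ∀ j, n' u' i - μ i ≤ n' u' j - μ j := fun hall =>
            h (le_antisymm (h₀ i) ((hAB i).2 hall i₀))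
          push Not at h2
          obtain ⟨j, hj⟩ := h2
          have := h₀' j
          omega
    refine (inf_le_inf inf_le_right hY').trans (hp.apartmentLattice_inf_le fun i => ?_)
    by_cases h : n u i - μ i = D
    · exact Or.inl (by omega)
    · exact Or.inr (by rw [if_neg h])

end Extremal

/-! ### Subquotients of `V` as residual representations -/

section Types

variable {O K V G : Type*} [CommRing O] [IsLocalRing O] [Field K]
  [Algebra O K] [AddCommGroup V] [Module K V]
  [Module O V] [IsScalarTower O K V] [Group G] {ρ : Representation K G V}
  {W W' : Type*} [AddCommGroup W] [Module (ResField O)[G] W] [AddCommGroup W']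
  [Module (ResField O)[G] W'] {N U X : Submodule O V}

/-- The element `a g` of the residual group algebra. -/
def residualSingle (g : G) (a : O) : (ResField O)[G] :=
  MonoidAlgebra.single g (Ideal.Quotient.mk (IsLocalRing.maximalIdeal O) a)

theorem residual_induction {P : (ResField O)[G] → Prop} (h0 : P 0)
    (hadd : ∀ x y, P x → P y → P (x + y)) (h : ∀ (g : G) (a : O), P (residualSingle g a))
    (x : (ResField O)[G]) : P x := by
  induction x using MonoidAlgebra.induction_linear with
  | zero => exact h0
  | add x y hx hy => exact hadd x y hx hy
  | single g c =>
    obtain ⟨a, rfl⟩ := Ideal.Quotient.mk_surjective c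
    exact h g a

/-- The quotient `U / N` is isomorphic to `W`, as a representation of `G`. -/
def HasType (ρ : Representation K G V) (W : Type*) [AddCommGroup W] [Module (ResField O)[G] W]
    (N U : Submodule O V) : Prop :=
  N ≤ U ∧ ∃ f : U →+ W, Function.Surjective f ∧ (∀ u, f u = 0 ↔ (u : V) ∈ N) ∧
    ∀ (g : G) (a : O) (u u' : U), (u' : V) = a • ρ g u → f u' = residualSingle g a • f u

/-- With `HasType.extend`, the two directions of the second isomorphism theorem. -/
theorem HasType.restrict (h : HasType ρ W N U) (hX : X ≤ U) (hNX : U ≤ N ⊔ X) :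
    HasType ρ W (N ⊓ X) X := by
  obtain ⟨hNU, f, hf, hker, hlin⟩ := h
  refine ⟨inf_le_right, f.comp (Submodule.inclusion hX).toAddMonoidHom, fun w => ?_, fun u => ?_,
    fun g a u u' h => hlin g a _ _ h⟩
  · obtain ⟨⟨u, hu⟩, rfl⟩ := hf w
    obtain ⟨n, hn, x, hx, rfl⟩ := Submodule.mem_sup.1 (hNX hu)
    refine ⟨⟨x, hx⟩, ?_⟩
    have h1 : f ⟨n, hNU hn⟩ = 0 := (hker _).2 hn
    have h2 : (⟨n + x, hu⟩ : U) = ⟨n, hNU hn⟩ + ⟨x, hX hx⟩ := rfl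
    rw [h2, map_add, h1, zero_add]
    rfl
  · exact (hker _).trans ⟨fun h => ⟨h, u.2⟩, fun h => h.1⟩

theorem HasType.extend (hN : IsStable ρ N) (hX : IsStable ρ X) (h : HasType ρ W (N ⊓ X) X) :
    HasType ρ W N (N ⊔ X) := by
  obtain ⟨-, f, hf, hker, hlin⟩ := h
  have hex : ∀ u : (N ⊔ X : Submodule O V), ∃ x : X, (u : V) - x ∈ N := by
    rintro ⟨u, hu⟩
    obtain ⟨n, hn, x, hx, rfl⟩ := Submodule.mem_sup.1 hu
    exact ⟨⟨x, hx⟩, by simpa using hn⟩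
  choose φ hφ using hex
  have huniq : ∀ (u : (N ⊔ X : Submodule O V)) (x : X), (u : V) - x ∈ N → f (φ u) = f x := by
    intro u x hx
    rw [← sub_eq_zero, ← map_sub, hker]
    refine ⟨?_, Subtype.property _⟩
    have := sub_mem hx (hφ u)
    rwa [sub_sub_sub_cancel_left] at this
  let f' : (N ⊔ X : Submodule O V) →+ W := AddMonoidHom.mk' (fun u => f (φ u)) (by
    intro u v
    rw [← map_add]
    refine huniq _ _ ?_
    have := add_mem (hφ u) (hφ v)
    rwa [← add_sub_add_comm] at this)
  refine ⟨le_sup_left, f', fun w => ?_, fun u => ?_, fun g a u u' h => ?_⟩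
  · obtain ⟨x, rfl⟩ := hf w
    exact ⟨⟨x, Submodule.mem_sup_right x.2⟩, huniq _ _ (by simp)⟩
  · refine (hker _).trans ⟨fun h => ?_, fun h => ⟨?_, (φ u).2⟩⟩
    · simpa using add_mem (hφ u) h.1
    · simpa using sub_mem h (hφ u)
  · have h1 : f ⟨a • ρ g (φ u), X.smul_mem a (hX g _ (φ u).2)⟩ = _ := hlin g a (φ u) _ rfl
    refine (huniq u' _ ?_).trans h1
    have := N.smul_mem a (hN g _ (hφ u))
    rwa [map_sub, smul_sub, ← h] at this

theorem HasType.smul (h : HasType ρ W N U) (a : Kˣ) : HasType ρ W (a • N) (a • U) := by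
  obtain ⟨hNU, f, hf, hker, hlin⟩ := h
  let e : (a • U : Submodule O V) →+ U :=
    AddMonoidHom.mk' (fun u => ⟨a⁻¹ • (u : V), mem_units_smul.1 u.2⟩)
      fun u v => Subtype.ext (smul_add a⁻¹ (u : V) v)
  refine ⟨units_smul_mono a hNU, f.comp e, fun w => ?_, fun u => ?_, fun g b u u' h => ?_⟩
  · obtain ⟨u, rfl⟩ := hf w
    exact ⟨⟨a • (u : V), smul_mem_units_smul a u.2⟩,
      congrArg f (Subtype.ext (inv_smul_smul a (u : V)))⟩
  · exact (hker _).trans mem_units_smul.symm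
  · refine hlin g b _ _ ?_
    change a⁻¹ • (u' : V) = b • ρ g (a⁻¹ • (u : V))
    rw [h, show ρ g (a⁻¹ • (u : V)) = a⁻¹ • ρ g u from (ρ g).map_smul _ _, smul_comm]

theorem HasType.nonempty_equiv (hU : IsStable ρ U) (h : HasType ρ W N U)
    (h' : HasType ρ W' N U) : Nonempty (W ≃ₗ[(ResField O)[G]] W') := by
  obtain ⟨-, f, hf, hker, hlin⟩ := h
  obtain ⟨-, f', hf', hker', hlin'⟩ := h'
  have hff : ∀ u v, f u = f v ↔ f' u = f' v := by
    intro u v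
    rw [← sub_eq_zero, ← map_sub, hker, ← hker', map_sub, sub_eq_zero]
  choose σ hσ using hf
  have hval : ∀ u, f' (σ (f u)) = f' u := fun u => (hff _ _).1 (hσ _)
  let e : W →ₗ[(ResField O)[G]] W' :=
    { toFun := fun w => f' (σ w)
      map_add' := fun w w' => by
        rw [← map_add, ← hff, map_add, hσ, hσ, hσ]
      map_smul' := fun x w => by
        rw [RingHom.id_apply]
        induction x using residual_induction generalizing w with
        | h0 =>
          rw [zero_smul, zero_smul, ← map_zero f', ← hff, hσ, map_zero]
        | hadd x y hx hy =>
          rw [add_smul, add_smul, ← hx, ← hy, ← map_add, ← hff, map_add, hσ, hσ, hσ]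
        | h g a =>
          rw [← hlin' g a (σ w) ⟨a • ρ g (σ w), U.smul_mem a (hU g _ (σ w).2)⟩ rfl, ← hff, hσ,
            hlin g a (σ w) _ rfl, hσ] }
  refine ⟨LinearEquiv.ofBijective e ⟨fun w w' h => ?_, fun w' => ?_⟩⟩
  · have := (hff _ _).2 h
    rwa [hσ, hσ] at this
  · obtain ⟨u, rfl⟩ := hf' w'
    exact ⟨f u, hval u⟩

theorem HasType.eq_or_eq [IsSimpleModule (ResField O)[G] W] (h : HasType ρ W N U)
    {Y : Submodule O V} (hY : IsStable ρ Y) (hNY : N ≤ Y) (hYU : Y ≤ U) : Y = N ∨ Y = U := by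
  obtain ⟨hNU, f, hf, hker, hlin⟩ := h
  let S : Submodule (ResField O)[G] W :=
    { carrier := {w | ∃ u : U, (u : V) ∈ Y ∧ f u = w}
      add_mem' := by
        rintro _ _ ⟨u, hu, rfl⟩ ⟨v, hv, rfl⟩
        exact ⟨u + v, add_mem hu hv, map_add f u v⟩
      zero_mem' := ⟨0, zero_mem Y, map_zero f⟩
      smul_mem' := by
        intro x
        induction x using residual_induction with
        | h0 =>
          intro w _
          exact ⟨0, zero_mem Y, by simp⟩
        | hadd x y hx hy =>
          intro w hw
          obtain ⟨u, hu, hu'⟩ := hx hw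
          obtain ⟨v, hv, hv'⟩ := hy hw
          exact ⟨u + v, add_mem hu hv, by rw [map_add, hu', hv', add_smul]⟩
        | h g a =>
          rintro _ ⟨u, hu, rfl⟩
          have hu' := Y.smul_mem a (hY g _ hu)
          exact ⟨⟨_, hYU hu'⟩, hu', hlin g a u _ rfl⟩ }
  rcases eq_bot_or_eq_top S with hS | hS
  · refine Or.inl (le_antisymm (fun v hv => ?_) hNY)
    have : f ⟨v, hYU hv⟩ ∈ S := ⟨⟨v, hYU hv⟩, hv, rfl⟩
    rw [hS, Submodule.mem_bot, hker] at this
    exact this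
  · refine Or.inr (le_antisymm hYU fun v hv => ?_)
    have : f ⟨v, hv⟩ ∈ S := hS ▸ Submodule.mem_top
    obtain ⟨u, hu, huv⟩ := this
    have h1 : v - u ∈ N := by
      have := (hker (⟨v, hv⟩ - u)).1 (by rw [map_sub, huv, sub_self])
      exact this
    simpa using add_mem (hNY h1) hu

theorem HasType.lt [Nontrivial W] (h : HasType ρ W N U) : N < U := by
  obtain ⟨hNU, f, hf, hker, -⟩ := h
  refine lt_of_le_not_ge hNU fun hUN => ?_
  obtain ⟨w, hw⟩ := exists_ne (0 : W)
  obtain ⟨u, rfl⟩ := hf w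
  exact hw ((hker u).2 (hUN u.2))

end Types

/-! ### Periodic chains and Jordan-Hölder arguments -/

section PeriodicChain

variable {O K V G : Type*} [CommRing O] [IsDomain O] [IsDiscreteValuationRing O] [Field K]
  [Algebra O K] [IsFractionRing O K] [AddCommGroup V] [Module K V] [FiniteDimensional K V]
  [Module O V] [IsScalarTower O K V] [Group G] {p : Kˣ} {ρ : Representation K G V} {r : ℕ}
  {W : ℤ → Type*} [∀ i, AddCommGroup (W i)] [∀ i, Module (ResField O)[G] (W i)]
  {D : ℤ → Submodule O V}

/-- A doubly infinite chain of stable lattices with successive quotients `W i` such that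
`D (i + r) = p⁻¹ D i`. -/
structure IsPeriodicChain (ρ : Representation K G V) (p : Kˣ) (r : ℕ) (W : ℤ → Type*)
    [∀ i, AddCommGroup (W i)] [∀ i, Module (ResField O)[G] (W i)]
    (D : ℤ → Submodule O V) : Prop where
  isStableLattice : ∀ i, IsStableLattice ρ (D i)
  period : ∀ i, D (i + r) = p⁻¹ • D i
  hasType : ∀ i, HasType ρ (W i) (D i) (D (i + 1))

/-- The indices at which the filtration induced on `N` by the chain `D` jumps. -/
def jumps (D : ℤ → Submodule O V) (N : Submodule O V) : Set ℤ := {i | ¬ N ⊓ D (i + 1) ≤ D i}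

theorem jumps_mono {N U : Submodule O V} (h : N ≤ U) : jumps D N ⊆ jumps D U :=
  fun _ hi hU => hi ((inf_le_inf_right _ h).trans hU)

/-- A submodule below `p Λ` in `M ≤ Λ` is in `p M` only if `M = Λ`. -/
theorem IsUniformiser.le_of_inf_smul_le (hp : IsUniformiser O p) {L M : Submodule O V}
    (hL : Submodule.IsLattice K L) (hM : Submodule.IsLattice K M) (h : M ⊓ p • L ≤ p • M) :
    L ≤ M := by
  -- Once `p ^ k L ≤ M`, this reads `p ^ k L ≤ p ^ k M`, and the power cancels.
  have key : ∀ k : ℕ, M ⊓ p ^ k • L ≤ p ^ k • M := by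
    intro k
    induction k with
    | zero => simp
    | succ k ih =>
      rintro x ⟨hxM, hxL⟩
      have hxL' : x ∈ p • p ^ k • L := by rwa [smul_smul, ← pow_succ']
      have hx := h ⟨hxM, units_smul_mono p (hp.pow_smul_le k L) hxL'⟩
      rw [pow_succ', mul_smul, mem_units_smul]
      rw [SetLike.mem_coe, mem_units_smul] at *
      exact mem_units_smul.1 (ih ⟨hx, hxL'⟩)
  obtain ⟨k, hk⟩ := hp.exists_pow_smul_le hL.fg hM.span_eq_top
  rw [← units_smul_le_units_smul (a := p ^ k)]
  exact (le_inf hk le_rfl).trans (key k)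

theorem IsUniformiser.exists_zpow_smul_le_and_not_le (hp : IsUniformiser O p) [Nontrivial V]
    {L M : Submodule O V} (hL : Submodule.IsLattice K L) (hM : Submodule.IsLattice K M) :
    ∃ k : ℤ, p ^ k • M ≤ L ∧ ¬ p ^ k • M ≤ p • L := by
  have hpL := Submodule.IsLattice.smul K L p
  obtain ⟨k, hk, hmax⟩ := Int.exists_greatest_of_bdd (P := fun k : ℤ => ¬ p ^ k • M ≤ p • L) (by
      obtain ⟨n, hn⟩ := hp.exists_pow_smul_le hM.fg hpL.span_eq_top
      refine ⟨n, fun k hk => ?_⟩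
      by_contra! hlt
      refine hk ((hp.zpow_smul_le_zpow_smul hlt.le M).trans ?_)
      rwa [zpow_natCast]) (by
      obtain ⟨n, hn⟩ := hp.exists_pow_smul_le hL.fg hM.span_eq_top
      refine ⟨-n, fun h => (hp.smul_lt hL).not_ge (le_trans ?_ h)⟩
      rwa [← units_smul_le_units_smul (a := p ^ n), zpow_neg, zpow_natCast, smul_inv_smul])
  refine ⟨k, ?_, hk⟩
  by_contra hcon
  have := hmax (k + 1) fun h => hcon (by
    rwa [add_comm, zpow_add, mul_smul, zpow_one, units_smul_le_units_smul] at h)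
  omega

namespace IsPeriodicChain

variable (hD : IsPeriodicChain ρ p r W D)
include hD

theorem period_mul (i k : ℤ) : D (i + r * k) = p ^ (-k) • D i := by
  induction k using Int.induction_on with
  | zero => simp
  | succ k ih =>
    rw [mul_add, mul_one, ← add_assoc, hD.period, ih, smul_smul, ← zpow_neg_one, ← zpow_add]
    congr 2
    ring
  | pred k ih =>
    have h := hD.period (i + r * (-k - 1))
    rw [show i + r * (-(k : ℤ) - 1) + r = i + r * (-k) by ring, ih] at h
    rw [← smul_left_cancel_iff p⁻¹, ← h, smul_smul, ← zpow_neg_one, ← zpow_add]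
    congr 2
    ring

theorem add_mul_mem_jumps_iff {N : Submodule O V} {i k : ℤ} :
    i + r * k ∈ jumps D N ↔ i ∈ jumps D (p ^ k • N) := by
  have h : N ⊓ D (i + r * k + 1) ≤ D (i + r * k) ↔ p ^ k • N ⊓ D (i + 1) ≤ D i := by
    rw [add_right_comm, hD.period_mul, hD.period_mul, ← units_smul_le_units_smul (a := p ^ k),
      units_smul_inf]
    simp [zpow_neg]
  exact not_congr h

/-- New jumps in two successive layers of `M / p M` are distinct modulo the period. Let `j = i + r
q`. For `q ≤ 0` the jump at `i` of `X₂` forces one at `j`; for `q > 0` the jump at `j` of `X₃`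
forces one at `i` of `p M`, hence of `X₀`. -/
theorem not_modEq_of_mem_jumps (hp : IsUniformiser O p) {M X₀ X₁ X₂ X₃ : Submodule O V} {i j : ℤ}
    (h₀ : p • M ≤ X₀) (h₁₂ : X₁ ≤ X₂) (h₃ : X₃ ≤ M) (hi : i ∈ jumps D X₁) (hi' : i ∉ jumps D X₀)
    (hj : j ∈ jumps D X₃) (hj' : j ∉ jumps D X₂) : ¬ i ≡ j [ZMOD r] := by
  intro h
  obtain ⟨q, hq⟩ := h.dvd
  obtain rfl : j = i + r * q := by linarith
  have hi₂ := jumps_mono h₁₂ hi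
  rcases lt_trichotomy q 0 with h0 | rfl | h0
  · rw [hD.add_mul_mem_jumps_iff] at hj'
    exact hj' (jumps_mono (hp.le_zpow_smul h0.le _) hi₂)
  · exact hj' (by simpa using hi₂)
  · rw [hD.add_mul_mem_jumps_iff] at hj
    refine hi' (jumps_mono ?_ hj)
    refine le_trans ?_ ((units_smul_mono p h₃).trans h₀)
    simpa using hp.zpow_smul_le_zpow_smul (m := 1) (n := q) (by omega) X₃

variable [∀ i, IsSimpleModule (ResField O)[G] (W i)]

theorem strictMono : StrictMono D :=
  strictMono_int_of_lt_succ fun i =>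
    have := IsSimpleModule.nontrivial (ResField O)[G] (W i)
    (hD.hasType i).lt

theorem pos (hp : IsUniformiser O p) : 0 < r := by
  by_contra! hr
  have h : r = 0 := by omega
  subst h
  have h1 := hD.period 0
  have h2 := hD.strictMono (show (0 : ℤ) < 1 by omega)
  obtain ⟨v, hv, hv'⟩ := SetLike.exists_of_lt h2
  have hv0 : v ≠ 0 := fun h => hv' (h ▸ zero_mem _)
  have : Nontrivial V := ⟨v, 0, hv0⟩
  refine (hp.smul_lt (hD.isStableLattice 0).1).ne ?_
  rw [← smul_left_cancel_iff p⁻¹, inv_smul_smul]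
  simpa using h1

theorem exists_le (hp : IsUniformiser O p) {L : Submodule O V} (hL : Submodule.IsLattice K L) :
    ∃ i, D i ≤ L := by
  obtain ⟨n, hn⟩ := hp.exists_pow_smul_le (hD.isStableLattice 0).1.fg hL.span_eq_top
  refine ⟨0 + r * (-n), ?_⟩
  rwa [hD.period_mul, neg_neg, zpow_natCast]

theorem exists_ge (hp : IsUniformiser O p) {L : Submodule O V} (hL : Submodule.IsLattice K L) :
    ∃ i, L ≤ D i := by
  obtain ⟨n, hn⟩ := hp.exists_pow_smul_le hL.fg (hD.isStableLattice 0).1.span_eq_top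
  refine ⟨0 + r * n, ?_⟩
  rwa [hD.period_mul, zpow_neg, zpow_natCast, ← units_smul_le_units_smul (a := p ^ n),
    smul_inv_smul]

theorem exists_inf_le_and_not_inf_le (hp : IsUniformiser O p) {N U : Submodule O V}
    (hN : Submodule.IsLattice K N) (hU : Submodule.IsLattice K U) (h : ¬ U ≤ N) :
    ∃ i, U ⊓ D i ≤ N ∧ ¬ U ⊓ D (i + 1) ≤ N := by
  obtain ⟨a, ha⟩ := hD.exists_le hp hN
  obtain ⟨b, hb⟩ := hD.exists_ge hp hU
  obtain ⟨i, hi, hmax⟩ := Int.exists_greatest_of_bdd (P := fun i => U ⊓ D i ≤ N)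
    ⟨b, fun i hi => by
      by_contra! hlt
      exact h ((le_inf le_rfl (hb.trans (hD.strictMono.monotone hlt.le))).trans hi)⟩
    ⟨a, inf_le_right.trans ha⟩
  refine ⟨i, hi, fun hcon => ?_⟩
  have := hmax _ hcon
  omega

theorem mem_jumps_iff {N : Submodule O V} (hN : IsStable ρ N) {i : ℤ} :
    i ∈ jumps D N ↔ D i ⊔ N ⊓ D (i + 1) = D (i + 1) := by
  have hlt := hD.strictMono (lt_add_one i)
  constructor
  · intro hi
    refine ((hD.hasType i).eq_or_eq ((hD.isStableLattice i).2.sup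
      (hN.inf (hD.isStableLattice _).2)) le_sup_left (sup_le hlt.le inf_le_right)).resolve_left ?_
    exact fun h => hi (le_sup_right.trans h.le)
  · intro h hle
    rw [sup_eq_left.2 hle] at h
    exact hlt.ne h

/-- If `N` jumped at `i`, the modular law would give `U ⊓ D (i + 1) = U ⊓ D i ⊔ N ⊓ D (i + 1)`,
which lies in `N`. -/
theorem mem_jumps_sdiff {N U : Submodule O V} (hN : IsStable ρ N) (hNU : N ≤ U) {i : ℤ}
    (hi : U ⊓ D i ≤ N) (hi' : ¬ U ⊓ D (i + 1) ≤ N) : i ∈ jumps D U ∧ i ∉ jumps D N := by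
  constructor
  · exact fun h => hi' ((le_inf inf_le_left h).trans hi)
  · rw [hD.mem_jumps_iff hN]
    intro h
    refine hi' ?_
    rw [← h, inf_comm, sup_comm, sup_inf_assoc_of_le _ (inf_le_left.trans hNU)]
    exact sup_le inf_le_left (inf_comm (D i) U ▸ hi)

theorem exists_mem_jumps_sdiff (hp : IsUniformiser O p) {N U : Submodule O V}
    (hN : IsStableLattice ρ N) (hU : IsStableLattice ρ U) (h : N < U) :
    ∃ i ∈ jumps D U, i ∉ jumps D N := by
  obtain ⟨i, hi, hi'⟩ := hD.exists_inf_le_and_not_inf_le hp hN.1 hU.1 h.not_ge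
  exact ⟨i, hD.mem_jumps_sdiff hN.2 h.le hi hi'⟩

/-- Zassenhaus's butterfly: both `U / N` and `D (i + 1) / D i` are the quotient of `U ⊓ D (i + 1)`
by the same submodule, `h4` being the equality of the two kernels. -/
theorem exists_mem_jumps_sdiff_hasType (hp : IsUniformiser O p) {N U : Submodule O V}
    (hN : IsStableLattice ρ N) (hU : IsStableLattice ρ U) {Q : Type*} [AddCommGroup Q]
    [Module (ResField O)[G] Q] [IsSimpleModule (ResField O)[G] Q] (h : HasType ρ Q N U) :
    ∃ i ∈ jumps D U, i ∉ jumps D N ∧ Nonempty (Q ≃ₗ[(ResField O)[G]] W i) := by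
  have := IsSimpleModule.nontrivial (ResField O)[G] Q
  obtain ⟨i, hi, hi'⟩ := hD.exists_inf_le_and_not_inf_le hp hN.1 hU.1 h.lt.not_ge
  obtain ⟨h1, h2⟩ := hD.mem_jumps_sdiff hN.2 h.lt.le hi hi'
  refine ⟨i, h1, h2, ?_⟩
  have hD1 := (hD.isStableLattice i).2
  have hX : IsStable ρ (U ⊓ D (i + 1)) := hU.2.inf (hD.isStableLattice _).2
  have hsup : N ⊔ U ⊓ D (i + 1) = U :=
    (h.eq_or_eq (hN.2.sup hX) le_sup_left (sup_le h.lt.le inf_le_left)).resolve_left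
      fun hcon => hi' (le_sup_right.trans hcon.le)
  have h3 := h.restrict inf_le_left hsup.ge
  have h4 : N ⊓ (U ⊓ D (i + 1)) = D i ⊓ (U ⊓ D (i + 1)) := by
    apply le_antisymm
    · refine le_inf ?_ inf_le_right
      exact (le_inf inf_le_left (inf_le_right.trans inf_le_right)).trans (not_not.1 h2)
    · refine le_inf ?_ inf_le_right
      exact (le_inf (inf_le_right.trans inf_le_left) inf_le_left).trans hi
  rw [h4] at h3
  have h5 := h3.extend hD1 hX
  rw [(hD.mem_jumps_iff hU.2).1 h1] at h5
  exact h5.nonempty_equiv (hD.isStableLattice _).2 (hD.hasType i)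

theorem card_le_of_mem_faces (hp : IsUniformiser O p) {π : O} (hπp : (p : K) = algebraMap O K π)
    {s : Finset (Vertex O K V)} (hs : s ∈ (invariantComplex (O := O) ρ π).faces) :
    s.card ≤ r := by
  obtain ⟨n, P, L, T, hcard, hP, hL, hPL, hPle, hLle, hLP⟩ := exists_chain_of_mem_faces hπp hs
  have : NeZero r := ⟨(hD.pos hp).ne'⟩
  choose i hi hi' using fun k => hD.exists_mem_jumps_sdiff hp (hP k) (hL k) (hPL k)
  have hne : ∀ k l, k < l → ¬ i k ≡ i l [ZMOD r] := fun k l hkl =>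
    hD.not_modEq_of_mem_jumps hp (hPle k) (hLP k l hkl) (hLle l) (hi k) (hi' k) (hi l) (hi' l)
  have hinj : Function.Injective fun k => (i k : ZMod r) := by
    intro k l h
    have h1 := (ZMod.intCast_eq_intCast_iff _ _ _).1 h
    by_contra hkl
    rcases lt_or_gt_of_ne hkl with h2 | h2
    · exact hne k l h2 h1
    · exact hne l k h2 h1.symm
  have := Fintype.card_le_of_injective _ hinj
  rw [Fintype.card_fin, ZMod.card] at this
  exact hcard.trans this

/-- This identifies the unique cover as `L ⊔ D (i + 1)`. It meets `X` strictly above `L`, and by the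
modular law the intersection is `L ⊔ X ⊓ D (i + 1)`; simplicity of `D (i + 1) / D i` does the rest.
-/
theorem le_of_hasUniqueCover {L X : Submodule O V} (hL : IsStableLattice ρ L)
    (h : HasUniqueCover ρ L) {i : ℤ} (hi : D i ≤ L) (hi' : ¬ D (i + 1) ≤ L)
    (hX : IsStableLattice ρ X) (hLX : L < X) : D (i + 1) ≤ X := by
  have hlt := h.lt_inf hX (hL.sup (hD.isStableLattice (i + 1))) hLX
    (lt_of_le_of_ne le_sup_left fun h => hi' (le_sup_right.trans h.ge))
  rcases (hD.hasType i).eq_or_eq (hX.2.inf (hD.isStableLattice (i + 1)).2)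
    (le_inf (hi.trans hLX.le) (hD.strictMono (lt_add_one i)).le) inf_le_right with h1 | h1
  · rw [inf_comm, sup_inf_assoc_of_le _ hLX.le, inf_comm, h1, sup_eq_left.2 hi] at hlt
    exact absurd hlt (lt_irrefl _)
  · exact h1.ge.trans inf_le_left

theorem hasType_sup {L : Submodule O V} (hL : IsStable ρ L) {i : ℤ} (hi : D i ≤ L)
    (hi' : ¬ D (i + 1) ≤ L) : HasType ρ (W i) L (L ⊔ D (i + 1)) := by
  refine HasType.extend hL (hD.isStableLattice _).2 ?_
  have h1 : L ⊓ D (i + 1) = D i := ((hD.hasType i).eq_or_eq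
    (hL.inf (hD.isStableLattice (i + 1)).2)
    (le_inf hi (hD.strictMono (lt_add_one i)).le) inf_le_right).resolve_right
      fun h => hi' (h.ge.trans inf_le_left)
  rw [h1]
  exact hD.hasType i

/-- If the `W i` within a period are pairwise non-isomorphic, a lattice with a unique cover is
determined up to homothety by the first term of the chain that it does not contain, modulo the
period. -/
theorem exists_eq_zpow_smul (hp : IsUniformiser O p)
    (hW : ∀ i j, Nonempty (W i ≃ₗ[(ResField O)[G]] W j) → i ≡ j [ZMOD r])
    {L M : Submodule O V} (hL : IsStableLattice ρ L) (hM : IsStableLattice ρ M)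
    (hLc : HasUniqueCover ρ L) (hMc : HasUniqueCover ρ M) {i j : ℤ}
    (hi : D i ≤ L) (hi' : ¬ D (i + 1) ≤ L) (hj : D j ≤ M) (hj' : ¬ D (j + 1) ≤ M)
    (hij : i ≡ j [ZMOD r]) : ∃ k : ℤ, L = p ^ k • M := by
  have : Nontrivial V := by
    obtain ⟨v, hv, -⟩ := hLc
    exact ⟨v, 0, fun h => hv (h ▸ zero_mem _)⟩
  obtain ⟨k, hk, hk'⟩ := hp.exists_zpow_smul_le_and_not_le hL.1 hM.1
  refine ⟨k, ?_⟩
  by_contra hne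
  set N := p ^ k • M with hN
  have hNst : IsStableLattice ρ N := hM.smul _
  have hdown : ∀ (X : Submodule O V) (l m : ℤ), D l ≤ X ↔ D (l + r * (-m)) ≤ p ^ m • X := by
    intro X l m
    rw [hD.period_mul, neg_neg, units_smul_le_units_smul]
  have hpL : p • L = p ^ (1 : ℤ) • L := by rw [zpow_one]
  have hpN : p • N = p ^ (k + 1) • M := by rw [add_comm, zpow_add, mul_smul, zpow_one]
  have hLst' : IsStableLattice ρ (p • L) := hL.smul p
  have hNst' : IsStableLattice ρ (p • N) := hNst.smul p
  have hLc' : HasUniqueCover ρ (p • L) := hLc.smul p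
  have hNc' : HasUniqueCover ρ (p • N) := (hMc.smul _).smul p
  have hi₁ : D (i + r * (-1)) ≤ p • L := hpL ▸ (hdown L i 1).1 hi
  have hi₁' : ¬ D (i + r * (-1) + 1) ≤ p • L := fun h => hi' <| (hdown L (i + 1) 1).2 <| by
    rwa [add_right_comm, ← hpL]
  have hj₁ : D (j + r * (-(k + 1))) ≤ p • N := hpN ▸ (hdown M j (k + 1)).1 hj
  have hj₁' : ¬ D (j + r * (-(k + 1)) + 1) ≤ p • N := fun h => hj' <|
    (hdown M (j + 1) (k + 1)).2 <| by rwa [add_right_comm, ← hpN]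
  have h1 := hD.hasType_sup hNst'.2 hj₁ hj₁'
  have h2 := hD.hasType_sup hLst'.2 hi₁ hi₁'
  -- If `N ≠ L`, the cover of `p N` lies in `N ⊓ p L`, while the cover `A` of `p L` lies in `p L ⊔
  -- N`. So `N / p N` has two separate layers, below `p L ⊓ N ⊓ A` and from there to `N ⊓ A`, whose
  -- factors belong to the same residue modulo `r`. Their jumps are then congruent, which
  -- `not_modEq_of_mem_jumps` forbids.
  have hlt : p • N < N ⊓ p • L := by
    refine lt_of_le_not_ge (le_inf (hp.smul_le N) (units_smul_mono p hk)) fun hcon => ?_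
    exact hne (le_antisymm (hp.le_of_inf_smul_le hL.1 hNst.1 hcon) hk)
  have h3 := hD.le_of_hasUniqueCover hNst' hNc' hj₁ hj₁' (hNst.inf hLst') hlt
  have h4 := hD.le_of_hasUniqueCover hLst' hLc' hi₁ hi₁' (hLst'.sup hNst)
    (lt_of_le_of_ne le_sup_left fun h => hk' (le_sup_right.trans h.ge))
  set A := p • L ⊔ D (i + r * (-1) + 1) with hA
  have hAst : IsStableLattice ρ A := hLst'.sup (hD.isStableLattice _)
  have h5 : HasType ρ (W (i + r * (-1))) (p • L ⊓ (N ⊓ A)) (N ⊓ A) := by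
    refine h2.restrict inf_le_right ?_
    rw [← sup_inf_assoc_of_le _ (show p • L ≤ A from le_sup_left)]
    exact le_inf (sup_le le_sup_left h4) le_rfl
  obtain ⟨a, ha, ha', e⟩ := hD.exists_mem_jumps_sdiff_hasType hp hNst'
    (hNst'.sup (hD.isStableLattice _)) h1
  obtain ⟨b, hb, hb', e'⟩ := hD.exists_mem_jumps_sdiff_hasType hp (hLst'.inf (hNst.inf hAst))
    (hNst.inf hAst) h5
  refine hD.not_modEq_of_mem_jumps hp le_rfl (sup_le ?_ ?_) inf_le_left ha ha' hb hb' ?_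
  · exact le_inf (hlt.le.trans inf_le_right)
      (le_inf (hlt.le.trans inf_le_left) (hlt.le.trans (inf_le_right.trans le_sup_left)))
  · exact le_inf (h3.trans inf_le_right)
      (le_inf (h3.trans inf_le_left) (h3.trans (inf_le_right.trans le_sup_left)))
  · have hmod : ∀ l m : ℤ, l + r * m ≡ l [ZMOD r] := fun l m => by
      simp [Int.ModEq]
    exact (hW _ _ e).symm.trans ((hmod _ _).trans (hij.symm.trans
      ((hmod _ _).symm.trans (hW _ _ e'))))

theorem encard_maximalVertices_le (hp : IsUniformiser O p) {π : O}
    (hπp : (p : K) = algebraMap O K π)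
    (hW : ∀ i j, Nonempty (W i ≃ₗ[(ResField O)[G]] W j) → i ≡ j [ZMOD r]) :
    (maximalVertices (O := O) ρ π).encard ≤ r := by
  have : NeZero r := ⟨(hD.pos hp).ne'⟩
  -- The index of the last term of `D` inside a representative; it is an arbitrary `0` at other
  -- vertices.
  have hex : ∀ x : Vertex O K V, ∃ i : ℤ, x ∈ maximalVertices ρ π →
      ∃ L : Lattice O K V, L.vertex = x ∧ IsStable ρ L.1 ∧ HasUniqueCover ρ L.1 ∧
        D i ≤ L.1 ∧ ¬ D (i + 1) ≤ L.1 := by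
    intro x
    by_cases hx : x ∈ maximalVertices ρ π
    · obtain ⟨L, hLx, hL, hc⟩ := exists_hasUniqueCover_of_mem_maximalVertices hπp hx
      obtain ⟨n, hn⟩ := hD.exists_ge hp L.2
      have hnot : ¬ D (n + 1) ≤ L.1 := fun h =>
        (hD.strictMono (lt_add_one n)).not_ge (h.trans hn)
      obtain ⟨i, hi, hi'⟩ := hD.exists_inf_le_and_not_inf_le hp L.2
        (hD.isStableLattice (n + 1)).1 hnot
      have hi2 : i ≤ n := by
        by_contra! hlt
        rw [inf_eq_left.2 (hD.strictMono.monotone (Int.add_one_le_iff.2 hlt))] at hi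
        exact hnot hi
      rw [inf_eq_right.2 (hD.strictMono.monotone (by omega))] at hi hi'
      exact ⟨i, fun _ => ⟨L, hLx, hL, hc, hi, hi'⟩⟩
    · exact ⟨0, fun h => absurd h hx⟩
  choose i hi using hex
  have hinj : Set.InjOn (fun x => (i x : ZMod r)) (maximalVertices ρ π) := by
    intro x hx y hy hxy
    obtain ⟨L, hLx, hL, hLc, hi₁, hi₂⟩ := hi x hx
    obtain ⟨M, hMy, hM, hMc, hj₁, hj₂⟩ := hi y hy
    obtain ⟨k, hk⟩ := hD.exists_eq_zpow_smul hp hW ⟨L.2, hL⟩ ⟨M.2, hM⟩ hLc hMc hi₁ hi₂ hj₁ hj₂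
      ((ZMod.intCast_eq_intCast_iff _ _ _).1 hxy)
    rw [← hLx, ← hMy, eq_comm, vertex_eq_iff_zpow hp]
    exact ⟨k, hk⟩
  refine (Set.encard_le_encard_of_injOn (t := Set.univ) (fun _ _ => trivial) hinj).trans ?_
  simp

end IsPeriodicChain

end PeriodicChain

/-! ### Direct sums of simple modules -/

section SimpleModules

variable {A : Type*} [Ring A]

/-- If a direct sum of simple modules embeds in a direct sum of pairwise non-isomorphic simple
modules, then its summands are pairwise non-isomorphic. -/
theorem eq_of_nonempty_linearEquiv_of_pi_equiv {ι κ : Type*} [DecidableEq κ]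
    {W : ι → Type*} [∀ i, AddCommGroup (W i)] [∀ i, Module A (W i)] [∀ i, IsSimpleModule A (W i)]
    {Q : κ → Type*} [∀ j, AddCommGroup (Q j)] [∀ j, Module A (Q j)] [∀ j, IsSimpleModule A (Q j)]
    (hW : ∀ i i', i ≠ i' → IsEmpty (W i ≃ₗ[A] W i')) (e : (∀ j, Q j) ≃ₗ[A] (∀ i, W i))
    {j k : κ} (hjk : Nonempty (Q j ≃ₗ[A] Q k)) : j = k := by
  by_contra hne
  obtain ⟨φ⟩ := hjk
  let f : ∀ (l : κ) (i : ι), Q l →ₗ[A] W i := fun l i =>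
    (LinearMap.proj i).comp (e.toLinearMap.comp (LinearMap.single A Q l))
  have hval : ∀ l i x, f l i x = e (Pi.single l x) i := fun l i x => rfl
  -- By Schur's lemma each component is zero or an isomorphism, so each `Q l` maps onto a single `W
  -- i`. Isomorphic `Q j` and `Q k` share this `i` and have the same image, against injectivity of
  -- `e`.
  have hexists : ∀ l, ∃ i, Function.Bijective (f l i) := by
    intro l
    by_contra! hcon
    have hzero : ∀ i, f l i = 0 := fun i =>
      (LinearMap.bijective_or_eq_zero (f l i)).resolve_left (hcon i)
    have := IsSimpleModule.nontrivial A (Q l)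
    obtain ⟨x, hx⟩ := exists_ne (0 : Q l)
    have h1 : e (Pi.single l x) = 0 := funext fun i => by rw [← hval, hzero]; rfl
    rw [map_eq_zero_iff e e.injective, Pi.single_eq_zero_iff] at h1
    exact hx h1
  have huniq : ∀ l l' i i', Nonempty (Q l ≃ₗ[A] Q l') → Function.Bijective (f l i) →
      Function.Bijective (f l' i') → i = i' := by
    rintro l l' i i' ⟨ψ⟩ h h'
    by_contra hii
    exact (hW i i' hii).false
      ((LinearEquiv.ofBijective _ h).symm.trans (ψ.trans (LinearEquiv.ofBijective _ h')))
  obtain ⟨i, hi⟩ := hexists j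
  obtain ⟨i', hi'⟩ := hexists k
  obtain rfl := huniq j k i i' ⟨φ⟩ hi hi'
  have := IsSimpleModule.nontrivial A (Q j)
  obtain ⟨x, hx⟩ := exists_ne (0 : Q j)
  obtain ⟨y, hy⟩ := hi'.2 (f j i x)
  have h1 : e (Pi.single k y) = e (Pi.single j x) := by
    funext i'
    rw [← hval, ← hval]
    rcases eq_or_ne i' i with rfl | h
    · exact hy
    · have h2 : f j i' = 0 := (LinearMap.bijective_or_eq_zero _).resolve_left fun hb =>
        h (huniq j j i' i ⟨.refl _ _⟩ hb hi)
      have h3 : f k i' = 0 := (LinearMap.bijective_or_eq_zero _).resolve_left fun hb =>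
        h (huniq k k i' i ⟨.refl _ _⟩ hb hi')
      rw [h2, h3]
      rfl
  have h2 := congrFun (e.injective h1) j
  rw [Pi.single_eq_same, Pi.single_eq_of_ne hne] at h2
  exact hx h2.symm

theorem length_pi_simple {ι : Type*} [Fintype ι] (Q : ι → Type*) [∀ j, AddCommGroup (Q j)]
    [∀ j, Module A (Q j)] [∀ j, IsSimpleModule A (Q j)] :
    Module.length A (∀ j, Q j) = Fintype.card ι := by
  simp [Module.length_pi_of_fintype, Module.length_eq_one]

end SimpleModules

/-! ### Lifting submodules of the reduction -/

section Reduction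

variable {O K V G : Type*} [CommRing O] [IsLocalRing O] [Field K]
  [Algebra O K] [AddCommGroup V] [Module K V]
  [Module O V] [IsScalarTower O K V] [Group G] {ρ : Representation K G V}
  {L : Submodule O V} (hL : IsStable ρ L)

/-- The reduction map, with values in the module over the residual group algebra. -/
def reductionMap : L →+ (residualRep ρ L hL).asModule :=
  ((residualRep ρ L hL).asModuleEquiv.symm.toLinearMap.toAddMonoidHom).comp
    (IsLocalRing.maximalIdeal O • ⊤ : Submodule O L).mkQ.toAddMonoidHom

theorem reductionMap_surjective : Function.Surjective (reductionMap hL) :=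
  (residualRep ρ L hL).asModuleEquiv.symm.surjective.comp (Submodule.mkQ_surjective _)

theorem reductionMap_eq_zero_iff (u : L) :
    reductionMap hL u = 0 ↔ u ∈ (IsLocalRing.maximalIdeal O • ⊤ : Submodule O L) :=
  ((residualRep ρ L hL).asModuleEquiv.symm.map_eq_zero_iff).trans
    (Submodule.Quotient.mk_eq_zero _)

theorem reductionMap_smul (g : G) (a : O) (u u' : L) (h : (u' : V) = a • ρ g u) :
    reductionMap hL u' = residualSingle g a • reductionMap hL u := by
  obtain rfl : u' = a • stableAction ρ L hL g u := Subtype.ext h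
  exact ((residualRep ρ L hL).single_smul
    (Ideal.Quotient.mk (IsLocalRing.maximalIdeal O) a) g (reductionMap hL u)).symm

/-- The submodule of `L` that reduces to `S`. -/
def preimageReduction (S : Submodule (ResField O)[G] (residualRep ρ L hL).asModule) :
    Submodule O V where
  carrier := {v | ∃ h : v ∈ L, reductionMap hL ⟨v, h⟩ ∈ S}
  add_mem' := by
    rintro v w ⟨hv, hv'⟩ ⟨hw, hw'⟩
    exact ⟨add_mem hv hw, by simpa [← map_add] using add_mem hv' hw'⟩
  zero_mem' := ⟨zero_mem L, by
    have : (⟨0, zero_mem L⟩ : L) = 0 := rfl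
    rw [this, map_zero]
    exact zero_mem S⟩
  smul_mem' := by
    rintro a v ⟨hv, hv'⟩
    refine ⟨L.smul_mem a hv, ?_⟩
    rw [reductionMap_smul hL 1 a ⟨v, hv⟩ _ (by simp)]
    exact S.smul_mem _ hv'

variable {S T : Submodule (ResField O)[G] (residualRep ρ L hL).asModule}

theorem isStable_preimageReduction : IsStable ρ (preimageReduction hL S) := by
  rintro g v ⟨hv, hv'⟩
  refine ⟨hL g v hv, ?_⟩
  rw [reductionMap_smul hL g 1 ⟨v, hv⟩ _ (by simp)]
  exact S.smul_mem _ hv'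

theorem preimageReduction_top : preimageReduction hL ⊤ = L :=
  le_antisymm (fun _ hv => hv.1) fun _ hv => ⟨hv, trivial⟩

theorem mem_preimageReduction_bot {v : V} : v ∈ preimageReduction hL ⊥ ↔
    ∃ h : v ∈ L, (⟨v, h⟩ : L) ∈ (IsLocalRing.maximalIdeal O • ⊤ : Submodule O L) :=
  exists_congr fun _ => reductionMap_eq_zero_iff hL _

theorem preimageReduction_mono (h : S ≤ T) : preimageReduction hL S ≤ preimageReduction hL T :=
  fun _ ⟨hv, hv'⟩ => ⟨hv, h hv'⟩

theorem hasType_preimageReduction (h : S ≤ T) :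
    HasType ρ (T ⧸ S.submoduleOf T) (preimageReduction hL S) (preimageReduction hL T) := by
  let φ : preimageReduction hL T →+ T :=
    AddMonoidHom.mk' (fun u => ⟨reductionMap hL ⟨u, u.2.1⟩, u.2.2⟩) fun u v =>
      Subtype.ext (map_add (reductionMap hL) ⟨u, u.2.1⟩ ⟨v, v.2.1⟩)
  refine ⟨preimageReduction_mono hL h, (S.submoduleOf T).mkQ.toAddMonoidHom.comp φ,
    (Submodule.mkQ_surjective _).comp ?_, fun u => ?_, fun g a u u' h => ?_⟩
  · rintro ⟨w, hw⟩
    obtain ⟨⟨v, hv⟩, rfl⟩ := reductionMap_surjective hL w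
    exact ⟨⟨v, hv, hw⟩, rfl⟩
  · refine (Submodule.Quotient.mk_eq_zero _).trans ?_
    exact ⟨fun h => ⟨u.2.1, h⟩, fun ⟨_, h⟩ => h⟩
  · have h1 : φ u' = residualSingle g a • φ u :=
      Subtype.ext (reductionMap_smul hL g a ⟨u, u.2.1⟩ ⟨u', u'.2.1⟩ h)
    change (S.submoduleOf T).mkQ (φ u') = _
    rw [h1, map_smul]
    rfl

end Reduction

/-! ### The periodic chain of a composition series -/

section Construction

variable {O K V G : Type*} [CommRing O] [IsDomain O] [IsDiscreteValuationRing O] [Field K]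
  [Algebra O K] [IsFractionRing O K] [AddCommGroup V] [Module K V] [FiniteDimensional K V]
  [Module O V] [IsScalarTower O K V] [Group G] {p : Kˣ} {ρ : Representation K G V} {r : ℕ}

/-- The index of `i` modulo `r`. -/
def residue (hr : 0 < r) (i : ℤ) : Fin r :=
  ⟨(i % r).toNat, by have := Int.emod_nonneg i (b := r) (by omega)
                     have := Int.emod_lt_of_pos i (b := r) (by omega)
                     omega⟩

theorem modEq_of_residue_eq {hr : 0 < r} {i j : ℤ} (h : residue hr i = residue hr j) :
    i ≡ j [ZMOD r] := by
  have h1 : (i % r).toNat = (j % r).toNat := congrArg Fin.val h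
  have := Int.emod_nonneg i (b := r) (by omega)
  have := Int.emod_nonneg j (b := r) (by omega)
  unfold Int.ModEq
  omega

/-- The periodic extension of a chain `C 0, ..., C r` with `C 0 = p C r`. -/
def periodicExtension (p : Kˣ) (hr : 0 < r) (C : Fin (r + 1) → Submodule O V) (i : ℤ) :
    Submodule O V :=
  p ^ (-(i / r)) • C (residue hr i).castSucc

/-- Only the end of a period matters: there the next term is a multiple of `C 0`, which `C 0 = p C
r` rewrites as a multiple of `C r`. -/
theorem periodicExtension_add_one (hr : 0 < r) {C : Fin (r + 1) → Submodule O V}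
    (hC : C 0 = p • C (Fin.last r)) (i : ℤ) :
    periodicExtension p hr C (i + 1) = p ^ (-(i / r)) • C (residue hr i).succ := by
  have hr' : (0 : ℤ) < r := by exact_mod_cast hr
  have h0 := Int.emod_nonneg i hr'.ne'
  have h1 := Int.emod_lt_of_pos i hr'
  have h2 := Int.mul_ediv_add_emod i r
  unfold periodicExtension
  rcases eq_or_ne (i % r) (r - 1) with h | h
  · have h3 : i + 1 = r * (i / r + 1) := by rw [mul_add]; omega
    have h4 : (i + 1) / r = i / r + 1 := by rw [h3, Int.mul_ediv_cancel_left _ hr'.ne']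
    have h5 : (i + 1) % r = 0 := by rw [h3, Int.mul_emod_right]
    have h6 : (residue hr (i + 1)).castSucc = 0 := Fin.ext (by simp [residue, h5])
    have h7 : (residue hr i).succ = Fin.last r := Fin.ext (by simp [residue]; omega)
    rw [h4, h6, h7, hC, smul_smul, ← zpow_add_one]
    congr 2
    ring
  · have h4 : (i + 1) / r = i / r := by
      rw [Int.ediv_eq_iff_of_pos hr']
      constructor <;> nlinarith [lt_of_le_of_ne (Int.le_sub_one_of_lt h1) h]
    have h5 : (i + 1) % r = i % r + 1 := by
      have := Int.mul_ediv_add_emod (i + 1) r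
      rw [h4] at this
      omega
    have h6 : (residue hr (i + 1)).castSucc = (residue hr i).succ :=
      Fin.ext (by simp [residue, h5]; omega)
    rw [h4, h6]

theorem isPeriodicChain_periodicExtension (hr : 0 < r) {C : Fin (r + 1) → Submodule O V}
    (hC : C 0 = p • C (Fin.last r)) (hst : ∀ i, IsStableLattice ρ (C i)) {Q : Fin r → Type*}
    [∀ i, AddCommGroup (Q i)] [∀ i, Module (ResField O)[G] (Q i)]
    (hQ : ∀ i, HasType ρ (Q i) (C i.castSucc) (C i.succ)) :
    IsPeriodicChain ρ p r (fun i => Q (residue hr i)) (periodicExtension p hr C) where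
  isStableLattice i := (hst _).smul _
  period i := by
    have hr' : (r : ℤ) ≠ 0 := by omega
    have h : residue hr (i + r) = residue hr i := Fin.ext (by simp [residue])
    unfold periodicExtension
    rw [h, Int.add_ediv_of_dvd_right dvd_rfl, Int.ediv_self hr', smul_smul, ← zpow_neg_one,
      ← zpow_add]
    congr 2
    ring
  hasType i := by
    rw [periodicExtension_add_one hr hC]
    exact (hQ _).smul _

theorem mem_faces_of_strictMono {π : O} (hπp : (p : K) = algebraMap O K π) (hr : 0 < r)
    (hp : IsUniformiser O p) [Nontrivial V] {C : Fin (r + 1) → Submodule O V}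
    (hC : C 0 = p • C (Fin.last r)) (hst : ∀ i, IsStableLattice ρ (C i)) (hmono : StrictMono C) :
    ∃ s ∈ (invariantComplex (O := O) ρ π).faces, s.card = r := by
  classical
  obtain ⟨n, rfl⟩ := Nat.exists_eq_add_of_le' hr
  -- The term `C 0` is left out, being homothetic to the last one.
  let L : Fin (n + 1) → Lattice O K V := fun i => ⟨C i.succ, (hst _).1⟩
  have hL : StrictMono fun i => (L i).1 := fun i j hij => hmono (Fin.succ_lt_succ_iff.2 hij)
  have hlt : p • (L (Fin.last n)).1 < (L 0).1 := hC ▸ hmono (Fin.succ_pos 0)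
  have hne : ∀ i j, i < j → (L i).vertex ≠ (L j).vertex := by
    intro i j hij h
    obtain ⟨k, hk⟩ := (vertex_eq_iff_zpow hp).1 h
    have h1 : (L i).1 < p ^ k • (L i).1 := hk ▸ hL hij
    have hk0 : k < 0 := by
      by_contra! hk0
      exact h1.not_ge (hp.zpow_smul_le hk0 _)
    have h2 : p ^ (-1 : ℤ) • (L i).1 ≤ (L (Fin.last n)).1 :=
      (hp.zpow_smul_le_zpow_smul (by omega) _).trans
        (hk.ge.trans (hL.monotone (Fin.le_last j)))
    rw [← units_smul_le_units_smul (a := p), zpow_neg_one, smul_inv_smul] at h2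
    exact (h2.trans_lt hlt).not_ge (hL.monotone (Fin.zero_le i))
  have hinj : Function.Injective fun i => (L i).vertex := by
    intro i j h
    by_contra hij
    rcases lt_or_gt_of_ne hij with h1 | h1
    · exact hne i j h1 h
    · exact hne j i h1 h.symm
  refine ⟨Finset.univ.image fun i => (L i).vertex, ⟨⟨n, L, hL, ?_, by simp⟩, ?_⟩, ?_⟩
  · rwa [smul_eq_units_smul hπp]
  · intro x hx
    obtain ⟨i, -, rfl⟩ := Finset.mem_image.1 hx
    exact ⟨L i, rfl, (hst _).2⟩
  · rw [Finset.card_image_of_injective _ hinj]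
    simp

theorem singleton_mem_faces {π : O} (hπp : (p : K) = algebraMap O K π) (hp : IsUniformiser O p)
    [Nontrivial V] (L : Lattice O K V) (hL : IsStable ρ L.1) :
    {L.vertex} ∈ (invariantComplex (O := O) ρ π).faces := by
  have : Subsingleton (Fin (0 + 1)) := inferInstanceAs (Subsingleton (Fin 1))
  refine ⟨⟨0, fun _ => L, Subsingleton.strictMono _, ?_, by simp [eq_comm]⟩, ?_⟩
  · rw [smul_eq_units_smul hπp]
    exact hp.smul_lt L.2
  · intro x hx
    exact ⟨L, (Finset.mem_singleton.1 hx).symm, hL⟩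

/-- The dimension of the invariant complex, and a bound for the number of maximal vertices, in
terms of a composition series of the reduction of a stable lattice. -/
theorem one_add_dim_eq_length {π : O} (hπp : (p : K) = algebraMap O K π)
    (hp : IsUniformiser O p) [Nontrivial V] {L : Lattice O K V} (hL : IsStable ρ L.1)
    (s : CompositionSeries (Submodule (ResField O)[G] (residualRep ρ L.1 hL).asModule))
    (hhead : s.head = ⊥) (hlast : s.last = ⊤) :
    1 + dim (invariantComplex (O := O) ρ π) = s.length ∧
      ((∀ i j, Nonempty
        ((s i.succ ⧸ (s i.castSucc).submoduleOf (s i.succ)) ≃ₗ[(ResField O)[G]]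
          (s (Fin.succ j) ⧸ (s j.castSucc).submoduleOf (s j.succ))) → i = j) →
        (maximalVertices (O := O) ρ π).encard ≤ s.length) := by
  obtain ⟨π', hπ', hpπ'⟩ := hp
  have hp : IsUniformiser O p := ⟨π', hπ', hpπ'⟩
  have := L.2
  let C : Fin (s.length + 1) → Submodule O V := fun i => preimageReduction hL (s i)
  have hC0 : C 0 = p • L.1 := by
    change preimageReduction hL s.head = _
    rw [hhead]
    ext v
    rw [mem_preimageReduction_bot, maximalIdeal_smul_eq_comap hπ' hpπ']
    exact ⟨fun ⟨_, h⟩ => h, fun h => ⟨hp.smul_le _ h, h⟩⟩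
  have hCl : C (Fin.last _) = L.1 := by
    change preimageReduction hL s.last = _
    rw [hlast, preimageReduction_top]
  have hle : ∀ i, C 0 ≤ C i := fun i =>
    preimageReduction_mono hL (s.strictMono.monotone (Fin.zero_le i))
  have hCst : ∀ i, IsStableLattice ρ (C i) := fun i =>
    ⟨isLattice_of_le_of_le (hC0 ▸ Submodule.IsLattice.smul K L.1 p) L.2.fg (hle i)
      fun v hv => hv.1, isStable_preimageReduction hL⟩
  have hCp : C 0 = p • C (Fin.last _) := by rw [hC0, hCl]
  let Q : Fin s.length → Type _ := fun i => s i.succ ⧸ (s i.castSucc).submoduleOf (s i.succ)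
  have hQ : ∀ i, HasType ρ (Q i) (C i.castSucc) (C i.succ) := fun i =>
    hasType_preimageReduction hL (s.step i).le
  have hsimple : ∀ i, IsSimpleModule (ResField O)[G] (Q i) := fun i =>
    (covBy_iff_quot_is_simple (s.step i).le).1 (s.step i)
  have hmono : StrictMono C := Fin.strictMono_iff_lt_succ.2 fun i =>
    have := IsSimpleModule.nontrivial (ResField O)[G] (Q i)
    (hQ i).lt
  have hr : 0 < s.length := by
    by_contra! h0
    have h1 : (Fin.last s.length) = 0 := Fin.ext (by simp; omega)
    rw [h1, hC0] at hCl
    exact (hp.smul_lt L.2).ne hCl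
  have hD := isPeriodicChain_periodicExtension hr hCp hCst hQ
  obtain ⟨t, ht, htc⟩ := mem_faces_of_strictMono hπp hr hp hCp hCst hmono
  refine ⟨le_antisymm (one_add_dim_le ⟨t, ht⟩ fun s' hs' => ?_) (htc ▸ le_one_add_dim ht),
    fun h => ?_⟩
  · exact_mod_cast hD.card_le_of_mem_faces hp hπp hs'
  · exact hD.encard_maximalVertices_le hp hπp fun i j hij => modEq_of_residue_eq (h _ _ hij)

end Construction

end StableLattices

end

theorem mainTheorem7 {O K V G : Type*} [CommRing O] [IsDomain O] [IsDiscreteValuationRing O]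
    [IsAdicComplete (IsLocalRing.maximalIdeal O) O] [Field K] [Algebra O K] [IsFractionRing O K]
    [AddCommGroup V] [Module K V] [FiniteDimensional K V] [Module O V] [IsScalarTower O K V]
    [Group G] (π : O) (hπ : Irreducible π) (ρ : Representation K G V) (hρ : ρ.IsIrreducible)
    (hstable : ∃ L : StableLattices.Lattice O K V, StableLattices.IsStable ρ L.1) :
    1 + StableLattices.dim (StableLattices.invariantComplex ρ π) ≤
        (StableLattices.maximalVertices ρ π).encard ∧
      (∀ (r : ℕ) (W : Fin r → Type*) [∀ i, AddCommGroup (W i)]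
        [∀ i, Module (MonoidAlgebra (StableLattices.ResField O) G) (W i)] (m : Fin r → ℕ),
        StableLattices.IsResidualDecomposition O ρ W m →
          1 + StableLattices.dim (StableLattices.invariantComplex ρ π) =
              ((∑ i, m i : ℕ) : ℕ∞) ∧
            ((∀ i, m i = 1) →
              (StableLattices.maximalVertices ρ π).encard =
                1 + StableLattices.dim (StableLattices.invariantComplex ρ π))) ∧
      1 + StableLattices.dim (StableLattices.invariantComplex ρ π) ≤
        (StableLattices.extremalVertices ρ π).encard := by
  open StableLattices in
  obtain ⟨p, hπp, hp⟩ := exists_isUniformiser (K := K) hπ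
  have : Nontrivial V := by
    by_contra hV
    rw [not_nontrivial_iff_subsingleton] at hV
    have := hρ.exists_pair_ne
    obtain ⟨S, T, hST⟩ := this
    exact hST (Subrepresentation.toSubmodule_injective (Subsingleton.elim _ _))
  obtain ⟨L₀, hL₀⟩ := hstable
  have hmax : 1 + dim (invariantComplex (O := O) ρ π) ≤
      (maximalVertices (O := O) ρ π).encard :=
    one_add_dim_le ⟨_, singleton_mem_faces hπp hp L₀ hL₀⟩ fun s hs =>
      card_le_encard_maximalVertices hp hπp hρ hs
  refine ⟨hmax, fun r W _ _ m h => ?_,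
    hmax.trans (Set.encard_le_encard (maximalVertices_subset_extremalVertices hp hπp))⟩
  obtain ⟨hW, hWW, L, hL, s, hhead, hlast, ⟨e⟩⟩ := h
  obtain ⟨hdim, hle⟩ := one_add_dim_eq_length hπp hp hL s hhead hlast
  have hsimple : ∀ i : Fin s.length, IsSimpleModule (MonoidAlgebra (ResField O) G)
      (s.toFun i.succ ⧸ (s.toFun i.castSucc).submoduleOf (s.toFun i.succ)) := fun i =>
    (covBy_iff_quot_is_simple (s.step i).le).1 (s.step i)
  -- Both sides are the length of the semisimplification.
  have hlen : ((∑ i, m i : ℕ) : ℕ∞) = s.length := by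
    have h1 := e.length_eq
    rw [Module.length_pi_of_fintype, length_pi_simple (A := MonoidAlgebra (ResField O) G)
      (fun i : Fin s.length => s.toFun i.succ ⧸ (s.toFun i.castSucc).submoduleOf (s.toFun i.succ))]
      at h1
    simpa [Module.length_pi_of_fintype, Module.length_eq_one] using h1
  refine ⟨hdim.trans hlen.symm, fun hm => le_antisymm ?_ hmax⟩
  rw [hdim]
  refine hle fun i j hij => ?_
  obtain rfl : m = fun _ => 1 := funext hm
  -- With all multiplicities `1`, the factors of the composition series have direct sum `⨁ W i`, so
  -- they are pairwise non-isomorphic.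
  exact eq_of_nonempty_linearEquiv_of_pi_equiv hWW
    (e.symm.trans (LinearEquiv.piCongrRight fun i => LinearEquiv.funUnique (Fin 1) _ (W i))) hij
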